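/- Let $\mathsf k$ be a field, $q, r \ge 1$, let $m_1,\dots,m_q$ be square-free monomials in $S=\mathsf k[x_1,\dots,x_n]$, and let $I=(m_1,\dots,m_q)$ (for example, let $m_1,\dots,m_q$ be the minimal generators of a square-free monomial ideal $I$). Let $S_{\mathcal E}=\mathsf k[x_A : \emptyset\ne A\subseteq\{1,\dots,q\}]$ and let $\mathcal E_q=(\epsilon_1,\dots,\epsilon_q)\subseteq S_{\mathcal E}$ with $\epsilon_i=\prod_{A\ni i}x_A$ be the $q$-extremal ideal. For $1\le t\le n$ put $A_t=\{j : x_t\mid m_j\}$, and let $\psi_I\colon S_{\mathcal E}\to S$ be the homomorphism of $\mathsf k$-algebras with $\psi_I(x_A)=\prod_{t:\,A_t=A}x_t$ (which is $1$ if there is no such $t$). The $\psi_I$-grading of $S_{\mathcal E}$ is the $\mathbb Z^n$-grading in which $x_A$ has the multidegree of $\psi_I(x_A)$; $\widetilde{S_{\mathcal E}}$ denotes $S_{\mathcal E}$ with this grading, and for a $\mathbb Z^{2^q-1}$-graded $S_{\mathcal E}$-module or complex $W$, $\widetilde W$ denotes $W$ with the $\mathbb Z^n$-grading that is induced from its grading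 in this way. For $\mathbf a\in\mathbb N^q$ write $\epsilon^{\mathbf a}=\epsilon_1^{a_1}\cdots\epsilon_q^{a_q}$ and $m^{\mathbf a}=m_1^{a_1}\cdots m_q^{a_q}$. Let $\mathrm{LCM}(\mathcal E_q^r)$ be the set of the least common multiples of nonempty sets of monomials $\epsilon^{\mathbf a}$ with $|\mathbf a|=a_1+\cdots+a_q=r$. Let $\beta_{i,\mathbf m}$ and $\beta_i$ denote the multigraded and the total betti numbers of an ideal, that is, the number of generators of multidegree $\mathbf m$, respectively of all generators, of the $i$-th module of its minimal multigraded free resolution. 1. If $F_\bullet$ is a multigraded free resolution of $\mathcal E_q^r$ over $S_{\mathcal E}$, then $\widetilde F_\bullet\otimes_{\widetilde{S_{\mathcal E}}}S$ is a multigraded free resolution of $I^r$ over $S$, where $S$ is a graded $\widetilde{S_{\mathcal E}}$-module via $\psi_I$; if $F_i=0$ for all $i>\ell$, then the same holds for the new resolution. 2. Let $\Delta$ be a simplicial complex whose vertices are vectors $\mathbf a\in\mathbb N^q$ with $|\mathbf a|=r$. If $\Delta$, with each vertex $\mathbf a$ labeled by $\epsilon^{\mathbf a}$, supports a free resolution of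 $\mathcal E_q^r$ (that is, its simplicial chain complex, homogenized by means of the labels, is a multigraded free resolution of $\mathcal E_q^r$), then $\Delta$, with each vertex $\mathbf a$ relabeled by $m^{\mathbf a}$, supports a free resolution of $I^r$. 3. For all $i\ge 0$ and all monomials $\mathbf m$ of $S$, $$\beta_{i,\mathbf m}(I^r)\le\sum_{\substack{\epsilon\in\mathrm{LCM}(\mathcal E_q^r)\\ \psi_I(\epsilon)=\mathbf m}}\beta_{i,\epsilon}(\mathcal E_q^r).$$ 4. For all $i\ge 0$, $\beta_i(I^r)\le\beta_i(\mathcal E_q^r)$. -/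

import Mathlib

open scoped TensorProduct

universe u

/-! ### Complexes of graded modules and base change -/

/-- A complex `⋯ → X 2 → X 1 → X 0` of `R`-modules, each of them with a family of additive subgroups
`gr i m` (the homogeneous elements of degree `m`), and with maps that preserve degrees. -/
structure GradedComplex (R : Type u) [CommRing R] (D : Type) where
  X : ℕ → Type u
  [addCommGroup : ∀ i, AddCommGroup (X i)]
  [module : ∀ i, Module R (X i)]
  gr : ∀ i, D → AddSubgroup (X i)
  d : ∀ i, X (i + 1) →ₗ[R] X i
  d_comp_d : ∀ i, d i ∘ₗ d (i + 1) = 0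
  d_mem : ∀ i m x, x ∈ gr (i + 1) m → d i x ∈ gr i m

attribute [instance] GradedComplex.addCommGroup GradedComplex.module

/-- The coarser grading along a map of degrees `φ`: the new piece of degree `m'` is the sum of the
old pieces of the degrees `m` with `φ m = m'`. -/
def regrade {M D D' : Type*} [AddCommGroup M] (φ : D → D') (gr : D → AddSubgroup M) :
    D' → AddSubgroup M :=
  fun m' => ⨆ (m : D) (_ : φ m = m'), gr m

/-- The grading of `S ⊗[R] M` that is induced by gradings of `S` and `M`: the piece of degree `m`
is generated by the tensors `s ⊗ x` with `s` and `x` homogeneous, of degrees that add up to `m`. -/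
def tensorGrading {D : Type*} [Add D] (R S M : Type*) [CommRing R] [CommRing S] [Algebra R S]
    [AddCommGroup M] [Module R M] (grS : D → AddSubgroup S) (grM : D → AddSubgroup M) :
    D → AddSubgroup (S ⊗[R] M) :=
  fun m => AddSubgroup.closure
    {t | ∃ (a e : D) (s : S) (x : M), s ∈ grS a ∧ x ∈ grM e ∧ a + e = m ∧ t = s ⊗ₜ[R] x}

/-- The same complex with the coarser grading along `φ`. -/
abbrev GradedComplex.regrade {R : Type u} [CommRing R] {D D' : Type} (F : GradedComplex R D)
    (φ : D → D') : GradedComplex R D' where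
  X := F.X
  gr i := _root_.regrade φ (F.gr i)
  d := F.d
  d_comp_d := F.d_comp_d
  d_mem i m' x hx := by
    have h : _root_.regrade φ (F.gr (i + 1)) m' ≤
        (_root_.regrade φ (F.gr i) m').comap (F.d i).toAddMonoidHom :=
      iSup₂_le fun m hm y hy =>
        (le_iSup₂ (f := fun (m : D) (_ : φ m = m') => F.gr i m) m hm) (F.d_mem i m y hy)
    exact h hx

/-- The base change `S ⊗[R] F` with the tensor product grading. -/
noncomputable abbrev GradedComplex.baseChange {R : Type u} [CommRing R] {D : Type} [Add D]
    (F : GradedComplex R D) (S : Type u) [CommRing S] [Algebra R S] (grS : D → AddSubgroup S) :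
    GradedComplex S D where
  X i := S ⊗[R] F.X i
  gr i := tensorGrading R S (F.X i) grS (F.gr i)
  d i := (F.d i).baseChange S
  d_comp_d i := by
    rw [← LinearMap.baseChange_comp, F.d_comp_d, LinearMap.baseChange_zero]
  d_mem i m x hx := by
    have h : tensorGrading R S (F.X (i + 1)) grS (F.gr (i + 1)) m ≤
        (tensorGrading R S (F.X i) grS (F.gr i) m).comap
          ((F.d i).baseChange S).toAddMonoidHom := by
      refine (AddSubgroup.closure_le _).2 ?_
      rintro _ ⟨a, e, s, y, hs, hy, hae, rfl⟩
      exact AddSubgroup.subset_closure ⟨a, e, s, F.d i y, hs, F.d_mem i e y hy, hae, by simp⟩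
    exact h hx

/-! ### Multigraded free resolutions of ideals of a polynomial ring -/

/-- An exponent vector as a multidegree. -/
def monDeg {σ : Type} (a : σ →₀ ℕ) : σ → ℤ := fun s => (a s : ℤ)

/-- The standard `ℤ^σ`-grading of the polynomial ring. -/
noncomputable def stdGrading (k : Type u) [Field k] (σ : Type) :
    (σ → ℤ) → AddSubgroup (MvPolynomial σ k) :=
  fun m => AddSubgroup.closure
    {p | ∃ (a : σ →₀ ℕ) (c : k), monDeg a = m ∧ p = MvPolynomial.monomial a c}

/-- `b` is a homogeneous basis, with `b j` of degree `deg j`: it identifies the module with the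
direct sum of copies of the ring that are shifted by the degrees `deg j`, as graded modules. -/
def IsHomogeneousBasis {k : Type u} [Field k] {σ : Type} {M : Type u} [AddCommGroup M]
    [Module (MvPolynomial σ k) M] (gr : (σ → ℤ) → AddSubgroup M) {ι : Type u}
    (b : Module.Basis ι (MvPolynomial σ k) M) (deg : ι → σ → ℤ) : Prop :=
  ∀ m, gr m = AddSubgroup.closure
    {x | ∃ (j : ι) (a : σ → ℤ), ∃ p ∈ stdGrading k σ a, a + deg j = m ∧ x = p • b j}

/-- Multigraded free modules. -/
def IsMultigradedFree (k : Type u) [Field k] {σ : Type} {M : Type u} [AddCommGroup M]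
    [Module (MvPolynomial σ k) M] (gr : (σ → ℤ) → AddSubgroup M) : Prop :=
  ∃ (ι : Type u) (b : Module.Basis ι (MvPolynomial σ k) M) (deg : ι → σ → ℤ),
    IsHomogeneousBasis gr b deg

/-- `F` is a multigraded free resolution of the ideal `J`: its modules are multigraded free, it is
exact in positive homological degrees, and there is a degree-preserving surjection from `F_0` onto
`J` whose kernel is the image of `F_1`, that is, `F_0 / im d ≅ J` as graded modules. -/
def IsMultigradedFreeResolution {k : Type u} [Field k] {σ : Type}
    (F : GradedComplex (MvPolynomial σ k) (σ → ℤ)) (J : Ideal (MvPolynomial σ k)) : Prop :=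
  (∀ i, IsMultigradedFree k (F.gr i)) ∧
  (∀ i, Function.Exact (F.d (i + 1)) (F.d i)) ∧
  ∃ ε : F.X 0 →ₗ[MvPolynomial σ k] MvPolynomial σ k,
    (∀ m x, x ∈ F.gr 0 m → ε x ∈ stdGrading k σ m) ∧
    LinearMap.range ε = J ∧ LinearMap.ker ε = LinearMap.range (F.d 0)

/-- Minimality: `d (F_{i+1}) ⊆ (x_1, …, x_n) F_i`. -/
def IsMinimalComplex {k : Type u} [Field k] {σ : Type}
    (F : GradedComplex (MvPolynomial σ k) (σ → ℤ)) : Prop :=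
  ∀ i, LinearMap.range (F.d i) ≤
    Ideal.span (Set.range (MvPolynomial.X : σ → MvPolynomial σ k)) •
      (⊤ : Submodule (MvPolynomial σ k) (F.X i))

/-- The multigraded betti number `β_{i,m}(J)`: the number of elements of degree `m` in a
homogeneous basis of `F_i`, where `F` is a minimal multigraded free resolution of `J`. The infimum
only serves to select this number, which depends neither on `F` nor on the basis. -/
noncomputable def multigradedBetti {k : Type u} [Field k] {σ : Type}
    (J : Ideal (MvPolynomial σ k)) (i : ℕ) (m : σ → ℤ) : ℕ :=
  sInf {c | ∃ F : GradedComplex (MvPolynomial σ k) (σ → ℤ),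
    IsMultigradedFreeResolution F J ∧ IsMinimalComplex F ∧
    ∃ (ι : Type u) (b : Module.Basis ι (MvPolynomial σ k) (F.X i)) (deg : ι → σ → ℤ),
      IsHomogeneousBasis (F.gr i) b deg ∧ c = Nat.card {j : ι // deg j = m}}

/-- The betti number `β_i(J)`: the rank of `F_i`, where `F` is a minimal multigraded free
resolution of `J` (it does not depend on `F`). -/
noncomputable def totalBetti {k : Type u} [Field k] {σ : Type}
    (J : Ideal (MvPolynomial σ k)) (i : ℕ) : ℕ :=
  sInf {c | ∃ F : GradedComplex (MvPolynomial σ k) (σ → ℤ),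
    IsMultigradedFreeResolution F J ∧ IsMinimalComplex F ∧
    c = Module.finrank (MvPolynomial σ k) (F.X i)}

/-! ### Labeled simplicial complexes and their homogenized chain complexes -/

section Homogenization

variable {V : Type} [LinearOrder V]

/-- The faces of dimension `i`. -/
abbrev FaceOfDim (Δ : PreAbstractSimplicialComplex V) (i : ℕ) : Type :=
  {s : Finset V // s ∈ Δ.faces ∧ s.card = i + 1}

/-- The facet `s \ {v}` of a face `s` of positive dimension. -/
def FaceOfDim.erase {Δ : PreAbstractSimplicialComplex V} {i : ℕ} (s : FaceOfDim Δ (i + 1))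
    (v : s.1) : FaceOfDim Δ i :=
  ⟨s.1.erase v, by
    have hc : (s.1.erase v).card = i + 1 := by
      rw [Finset.card_erase_of_mem v.2, s.2.2]; rfl
    exact ⟨(Δ.isRelLowerSet_faces s.2.1).2 (Finset.erase_subset _ _)
      (Finset.card_pos.1 (by omega)), hc⟩⟩

/-- The sign of `v` in the oriented face `s`. -/
def faceSign (s : Finset V) (v : V) : ℤ := (-1) ^ (s.filter (· < v)).card

/-- The monomial label of a face: the least common multiple of the labels of its vertices. -/
noncomputable def faceLabel {σ : Type} (label : V → σ →₀ ℕ) (s : Finset V) : σ →₀ ℕ :=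
  s.sup label

/-- The homogenized boundary `∑ v ∈ s, ± (m_s / m_{s \ v}) e_{s \ v}` of the face `s`. -/
noncomputable def faceBoundary (k : Type u) [Field k] {σ : Type}
    (Δ : PreAbstractSimplicialComplex V) (label : V → σ →₀ ℕ) (i : ℕ) (s : FaceOfDim Δ (i + 1)) :
    FaceOfDim Δ i →₀ MvPolynomial σ k :=
  ∑ v : s.1, Finsupp.single (s.erase v)
    (MvPolynomial.monomial (faceLabel label s.1 - faceLabel label (s.1.erase v))
      ((faceSign s.1 v : ℤ) : k))

theorem faceSign_erase (s : Finset V) {v w : V} (hv : v ∈ s) (hw : w ∈ s) (hvw : v ≠ w) :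
    faceSign s v * faceSign (s.erase v) w = -(faceSign s w * faceSign (s.erase w) v) := by
  wlog h : v < w generalizing v w
  · rw [this hw hv hvw.symm (lt_of_le_of_ne (not_lt.1 h) hvw.symm), neg_neg]
  have h1 : (s.erase w).filter (· < v) = s.filter (· < v) := by
    ext x; simp only [Finset.mem_filter, Finset.mem_erase]
    exact ⟨fun hx => ⟨hx.1.2, hx.2⟩, fun hx => ⟨⟨(hx.2.trans h).ne, hx.1⟩, hx.2⟩⟩
  have h2 : (s.erase v).filter (· < w) = (s.filter (· < w)).erase v := by
    ext x; simp only [Finset.mem_filter, Finset.mem_erase]; tauto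
  have h3 : v ∈ s.filter (· < w) := Finset.mem_filter.2 ⟨hv, h⟩
  have h4 := Finset.card_erase_add_one h3
  simp only [faceSign, h1, h2]
  rw [← h4, pow_succ]
  ring

theorem faceBoundary_comp (k : Type u) [Field k] {σ : Type}
    (Δ : PreAbstractSimplicialComplex V) (label : V → σ →₀ ℕ) (i : ℕ) :
    Finsupp.linearCombination (MvPolynomial σ k) (faceBoundary k Δ label i) ∘ₗ
      Finsupp.linearCombination (MvPolynomial σ k) (faceBoundary k Δ label (i + 1)) = 0 := by
  have key : ∀ s : FaceOfDim Δ (i + 1 + 1),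
      Finsupp.linearCombination (MvPolynomial σ k) (faceBoundary k Δ label i)
        (faceBoundary k Δ label (i + 1) s) = 0 := by
    intro s
    have hle : ∀ x y : Finset V, x ⊆ y → faceLabel label x ≤ faceLabel label y :=
      fun _ _ h => Finset.sup_mono h
    have hterm : ∀ (v : s.1) (w : (s.erase v).1),
        MvPolynomial.monomial (faceLabel label s.1 - faceLabel label (s.1.erase v))
            ((faceSign s.1 v : ℤ) : k) •
          Finsupp.single ((s.erase v).erase w)
            (MvPolynomial.monomial
              (faceLabel label (s.erase v).1 - faceLabel label ((s.erase v).1.erase w))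
              ((faceSign (s.erase v).1 w : ℤ) : k)) =
        Finsupp.single ((s.erase v).erase w)
          (MvPolynomial.monomial
            (faceLabel label s.1 - faceLabel label ((s.1.erase v).erase w))
            ((faceSign s.1 v * faceSign (s.1.erase v) w : ℤ) : k)) := by
      intro v w
      rw [Finsupp.smul_single, smul_eq_mul, MvPolynomial.monomial_mul]
      have hadd : faceLabel label s.1 - faceLabel label (s.1.erase v) +
          (faceLabel label (s.erase v).1 - faceLabel label ((s.erase v).1.erase w)) =
          faceLabel label s.1 - faceLabel label ((s.1.erase v).erase w) :=
        tsub_add_tsub_cancel (hle _ _ (Finset.erase_subset _ _))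
          (hle _ _ (Finset.erase_subset _ _))
      rw [hadd, Int.cast_mul]
      rfl
    rw [faceBoundary, map_sum]
    simp only [Finsupp.linearCombination_single]
    simp only [faceBoundary, Finset.smul_sum]
    simp only [hterm]
    rw [Finset.sum_sigma']
    have hmem : ∀ p : (v : s.1) × (s.erase v).1, p.2.1 ∈ s.1 ∧ p.2.1 ≠ p.1.1 := fun p =>
      ⟨Finset.mem_of_mem_erase p.2.2, Finset.ne_of_mem_erase p.2.2⟩
    refine Finset.sum_involution
      (fun p _ => ⟨⟨p.2.1, (hmem p).1⟩, ⟨p.1.1, Finset.mem_erase.2 ⟨(hmem p).2.symm, p.1.2⟩⟩⟩)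
      ?_ ?_ (fun _ _ => Finset.mem_univ _) (fun _ _ => rfl)
    · rintro ⟨v, w⟩ _
      have hvw := hmem ⟨v, w⟩
      have hface : (s.erase ⟨w.1, hvw.1⟩).erase
          ⟨v.1, Finset.mem_erase.2 ⟨hvw.2.symm, v.2⟩⟩ = (s.erase v).erase w :=
        Subtype.ext Finset.erase_right_comm
      have hset : (s.1.erase w.1).erase v.1 = (s.1.erase v.1).erase w.1 :=
        Finset.erase_right_comm
      have hsign := faceSign_erase s.1 v.2 hvw.1 hvw.2.symm
      dsimp only
      rw [hface, hset, hsign, Int.cast_neg, map_neg, Finsupp.single_neg, neg_add_cancel]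
    · rintro ⟨v, w⟩ _ _ heq
      have := congrArg (fun p : (v : s.1) × (s.erase v).1 => p.1.1) heq
      exact (hmem ⟨v, w⟩).2 this
  refine Finsupp.lhom_ext fun s c => ?_
  simp [Finsupp.linearCombination_single, key]

/-- The homogenization of the simplicial chain complex of `Δ`: the module in degree `i` is free on
the `i`-dimensional faces, and the basis element of a face has the degree of its label. -/
noncomputable abbrev homogenization (k : Type u) [Field k] {σ : Type}
    (Δ : PreAbstractSimplicialComplex V) (label : V → σ →₀ ℕ) :
    GradedComplex (MvPolynomial σ k) (σ → ℤ) where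
  X i := FaceOfDim Δ i →₀ MvPolynomial σ k
  gr i m := AddSubgroup.closure
    {x | ∃ (s : FaceOfDim Δ i) (a : σ →₀ ℕ) (c : k), monDeg a + monDeg (faceLabel label s.1) = m ∧
      x = Finsupp.single s (MvPolynomial.monomial a c)}
  d i := Finsupp.linearCombination (MvPolynomial σ k) (faceBoundary k Δ label i)
  d_comp_d i := faceBoundary_comp k Δ label i
  d_mem i m x hx := by
    induction hx using AddSubgroup.closure_induction with
    | mem x hx =>
      obtain ⟨s, a, c, hm, rfl⟩ := hx
      rw [Finsupp.linearCombination_single, faceBoundary, Finset.smul_sum]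
      refine sum_mem fun v _ => AddSubgroup.subset_closure ⟨s.erase v, _, _, ?_, by
        rw [Finsupp.smul_single, smul_eq_mul, MvPolynomial.monomial_mul]⟩
      rw [← hm]
      funext t
      have hle : faceLabel label (s.1.erase v) t ≤ faceLabel label s.1 t :=
        (Finset.sup_mono (Finset.erase_subset _ _) :
          faceLabel label (s.1.erase v) ≤ faceLabel label s.1) t
      have he : (s.erase v).1 = s.1.erase v := rfl
      simp only [monDeg, Pi.add_apply, he, Finsupp.add_apply, Finsupp.tsub_apply]
      push_cast [Nat.cast_sub hle]
      ring
    | zero => simp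
    | add x y _ _ hx hy => rw [map_add]; exact add_mem hx hy
    | neg x _ hx => rw [map_neg]; exact neg_mem hx

/-- `Δ`, with its vertices labeled by monomials, supports a free resolution of `J`. -/
def SupportsResolution (k : Type u) [Field k] {σ : Type} (Δ : PreAbstractSimplicialComplex V)
    (label : V → σ →₀ ℕ) (J : Ideal (MvPolynomial σ k)) : Prop :=
  IsMultigradedFreeResolution (homogenization k Δ label) J

end Homogenization

/-! ### Powers of monomial ideals and extremal ideals -/

/-- The ideal that is generated by the monomials with the exponent vectors `m j`. -/
noncomputable def monomialIdeal (k : Type u) [Field k] {σ : Type} {q : ℕ} (m : Fin q → σ →₀ ℕ) :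
    Ideal (MvPolynomial σ k) :=
  Ideal.span (Set.range fun j => MvPolynomial.monomial (m j) (1 : k))

/-- The vectors `a ∈ ℕ^q` with `a_1 + ⋯ + a_q = r`, ordered lexicographically. -/
abbrev PowerIndex (q r : ℕ) : Type :=
  {a : Lex (Fin q → ℕ) // a ∈ (Finset.piAntidiag Finset.univ r).map toLex.toEmbedding}

/-- The exponent vector of `m_1 ^ a_1 ⋯ m_q ^ a_q`. -/
noncomputable def powerLabel {σ : Type} {q r : ℕ} (m : Fin q → σ →₀ ℕ) (a : PowerIndex q r) :
    σ →₀ ℕ :=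
  ∑ j, ofLex a.1 j • m j

/-- The exponent vectors of the least common multiples of nonempty sets of the monomials
`m_1 ^ a_1 ⋯ m_q ^ a_q` with `a_1 + ⋯ + a_q = r`. -/
noncomputable def powerLCMs {σ : Type} {q : ℕ} (m : Fin q → σ →₀ ℕ) (r : ℕ) :
    Finset (σ →₀ ℕ) :=
  haveI := Classical.decEq (σ →₀ ℕ)
  (Finset.univ.filter fun T : Finset (PowerIndex q r) => T.Nonempty).image
    (faceLabel (powerLabel m))

/-- The index set of the variables `x_A` of `S_ℰ`: the nonempty subsets `A` of `[q]`. -/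
abbrev ExtremalVar (q : ℕ) : Type := {A : Finset (Fin q) // A.Nonempty}

/-- The exponent vector of `ε_i`, the product of the variables `x_A` with `i ∈ A`. -/
noncomputable def extremalGen (q : ℕ) (i : Fin q) : ExtremalVar q →₀ ℕ :=
  ∑ A with i ∈ A.1, Finsupp.single A 1

/-- The extremal ideal `ℰ_q`. -/
noncomputable def extremalIdeal (k : Type u) [Field k] (q : ℕ) :
    Ideal (MvPolynomial (ExtremalVar q) k) :=
  monomialIdeal k (extremalGen q)

/-- `A_t`, the set of those `j` for which `x_t` divides `m_j`. -/
def dividedSet {n q : ℕ} (m : Fin q → Fin n →₀ ℕ) (t : Fin n) : Finset (Fin q) :=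
  Finset.univ.filter fun j => m j t ≠ 0

/-- The homomorphism `ψ_I`, which sends `x_A` to the product of the variables `x_t` with `A_t = A`
(and so to `1` if there are none). -/
noncomputable def psi (k : Type u) [Field k] {n q : ℕ} (m : Fin q → Fin n →₀ ℕ) :
    MvPolynomial (ExtremalVar q) k →ₐ[k] MvPolynomial (Fin n) k :=
  MvPolynomial.aeval fun A => ∏ t with dividedSet m t = A.1, MvPolynomial.X t

/-- The `ψ_I`-grading: the additive map of degrees that sends the degree of `x_A` to the
multidegree of `ψ_I (x_A)`. -/
def psiDeg {n q : ℕ} (m : Fin q → Fin n →₀ ℕ) (e : ExtremalVar q → ℤ) : Fin n → ℤ :=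
  fun t => ∑ A, if dividedSet m t = A.1 then e A else 0

/-- `F̃ ⊗ S`: the complex `F` with the `ψ_I`-grading, tensored with `S` along `ψ_I`. -/
noncomputable def psiBaseChange {k : Type u} [Field k] {n q : ℕ} (m : Fin q → Fin n →₀ ℕ)
    (F : GradedComplex (MvPolynomial (ExtremalVar q) k) (ExtremalVar q → ℤ)) :
    GradedComplex (MvPolynomial (Fin n) k) (Fin n → ℤ) :=
  letI : Algebra (MvPolynomial (ExtremalVar q) k) (MvPolynomial (Fin n) k) :=
    (psi k m).toRingHom.toAlgebra
  (F.regrade (psiDeg m)).baseChange (MvPolynomial (Fin n) k) (stdGrading k (Fin n))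

/-- The monomials `ε` in `LCM(ℰ_q ^ r)` with `ψ_I(ε) = μ`. -/
noncomputable def lcmFiber (k : Type u) [Field k] {n q : ℕ} (m : Fin q → Fin n →₀ ℕ) (r : ℕ)
    (μ : Fin n →₀ ℕ) : Finset (ExtremalVar q →₀ ℕ) :=
  haveI := Classical.decEq (MvPolynomial (Fin n) k)
  (powerLCMs (extremalGen q) r).filter fun e =>
    psi k m (MvPolynomial.monomial e 1) = MvPolynomial.monomial μ 1

/-! Setting all variables to `1` turns a multigraded free complex with homogeneous bases into a
complex of `k`-vector spaces whose basis vectors carry degrees in `ℤ^σ`. The strand of degree `a` of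
the original complex is the span `degLE` of the basis vectors of degree at most `a`. Hence the
complex resolves a monomial ideal `J` iff each such subcomplex is a resolution of `k` when `a` is
the degree of a monomial of `J`, and of `0` otherwise (`IsFilteredResolution`).

Base change along `ψ_I` keeps the scalars and pushes the degrees forward along `psiDeg`. This map
selects coordinates, so it preserves joins, and a nonzero element of a pushed-forward piece already
lies in an old piece (`exists_degree_bound`). Therefore exactness survives
(`IsFilteredResolution.map`). Square-freeness gives that `ε^a` goes to `m^a`, so the ideal resolved
afterwards is `I^r`. For a simplicial complex the scalars are the ordinary boundary signs under
either labeling, and labels of faces are joins, so relabeling is the same operation.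

For the betti numbers, a minimal resolution of `ℰ_q^r` with degrees in the lcm set is pushed forward
to a possibly non-minimal resolution of `I^r`. Comparison maps `f`, `g` between it and a minimal
resolution of `I^r` have `g f` homotopic to the identity, and by minimality `g f` is then the
identity on generators of equal degree. So the minimal generators of each degree embed
(`fiber_embedding`). The existence of minimal resolutions (`exists_minimal_filteredResolution`) is
needed because the betti numbers are infima, which would be `0` on empty sets. -/

/-! ### Complexes of filtered vector spaces with bases -/

section Filtered

variable {k : Type u} [Field k] {P : Type*}

/-- The span of the basis vectors of degree at most `a`. -/
def degLE (k : Type u) [Field k] [LE P] {ι : Type*} (deg : ι → P) (a : P) :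
    Submodule k (ι →₀ k) :=
  Finsupp.supported k k {j | deg j ≤ a}

theorem mem_degLE [LE P] {ι : Type*} {deg : ι → P} {a : P} {x : ι →₀ k} :
    x ∈ degLE k deg a ↔ ∀ j, x j ≠ 0 → deg j ≤ a := by
  simp [degLE, Finsupp.mem_supported, Set.subset_def]

theorem single_mem_degLE [LE P] {ι : Type*} {deg : ι → P} {a : P} {j : ι} (h : deg j ≤ a)
    (c : k) : Finsupp.single j c ∈ degLE k deg a :=
  Finsupp.single_mem_supported k c h

theorem degLE_mono [Preorder P] {ι : Type*} {deg : ι → P} {a b : P} (h : a ≤ b) :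
    degLE k deg a ≤ degLE k deg b :=
  Finsupp.supported_mono fun _ hj => le_trans hj h

/-- A linear map is filtered if it does not increase degrees. -/
def IsFiltered [LE P] {ι κ : Type*} (deg : ι → P) (deg' : κ → P)
    (f : (ι →₀ k) →ₗ[k] (κ →₀ k)) : Prop :=
  ∀ j, f (Finsupp.single j 1) ∈ degLE k deg' (deg j)

theorem linearMap_finsupp_apply {V : Type*} [AddCommGroup V] [Module k V] {ι : Type*}
    (f : (ι →₀ k) →ₗ[k] V) (x : ι →₀ k) : f x = x.sum fun j c => c • f (Finsupp.single j 1) := by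
  conv_lhs => rw [← Finsupp.sum_single x]
  rw [Finsupp.sum, map_sum, Finsupp.sum]
  refine Finset.sum_congr rfl fun j _ => ?_
  rw [← map_smul, Finsupp.smul_single, smul_eq_mul, mul_one]

theorem IsFiltered.map_mem [Preorder P] {ι κ : Type*} {deg : ι → P} {deg' : κ → P}
    {f : (ι →₀ k) →ₗ[k] (κ →₀ k)} (hf : IsFiltered deg deg' f) {a : P} {x : ι →₀ k}
    (hx : x ∈ degLE k deg a) : f x ∈ degLE k deg' a := by
  rw [linearMap_finsupp_apply]
  exact sum_mem fun j hj => Submodule.smul_mem _ _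
    (degLE_mono (mem_degLE.1 hx j (Finsupp.mem_support_iff.1 hj)) (hf j))

theorem IsFiltered.comp [Preorder P] {ι κ l : Type*} {deg : ι → P} {deg' : κ → P} {deg'' : l → P}
    {f : (ι →₀ k) →ₗ[k] (κ →₀ k)} {g : (κ →₀ k) →ₗ[k] (l →₀ k)}
    (hg : IsFiltered deg' deg'' g) (hf : IsFiltered deg deg' f) :
    IsFiltered deg deg'' (g ∘ₗ f) :=
  fun j => hg.map_mem (hf j)

theorem IsFiltered.sub [Preorder P] {ι κ : Type*} {deg : ι → P} {deg' : κ → P}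
    {f g : (ι →₀ k) →ₗ[k] (κ →₀ k)} (hf : IsFiltered deg deg' f) (hg : IsFiltered deg deg' g) :
    IsFiltered deg deg' (f - g) :=
  fun j => sub_mem (hf j) (hg j)

theorem IsFiltered.id [Preorder P] {ι : Type*} {deg : ι → P} :
    IsFiltered deg deg (LinearMap.id : (ι →₀ k) →ₗ[k] (ι →₀ k)) :=
  fun _ => single_mem_degLE le_rfl 1

/-- The cycles of an augmented complex. -/
noncomputable def augCycles {ι : ℕ → Type*} (L : ∀ i, (ι (i + 1) →₀ k) →ₗ[k] (ι i →₀ k))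
    (aug : (ι 0 →₀ k) →ₗ[k] k) : ∀ i, Submodule k (ι i →₀ k)
  | 0 => LinearMap.ker aug
  | i + 1 => LinearMap.ker (L i)

/-- The complex of based filtered vector spaces is, in each filtration degree `a`, a resolution of
`k` if `a ∈ U` and of `0` otherwise. -/
structure IsFilteredResolution [LE P] {ι : ℕ → Type*} (deg : ∀ i, ι i → P)
    (L : ∀ i, (ι (i + 1) →₀ k) →ₗ[k] (ι i →₀ k)) (aug : (ι 0 →₀ k) →ₗ[k] k) (U : Set P) :
    Prop where
  filtered : ∀ i, IsFiltered (deg (i + 1)) (deg i) (L i)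
  mem_cycles : ∀ i y, L i y ∈ augCycles L aug i
  exact : ∀ i a x, x ∈ degLE k (deg i) a → x ∈ augCycles L aug i →
    ∃ y ∈ degLE k (deg (i + 1)) a, L i y = x
  aug_iff : ∀ a, a ∈ U ↔ ∃ x ∈ degLE k (deg 0) a, aug x ≠ 0

/-- The bound is the join of the degrees in the finite support. The support must be nonempty because
`P` need not have a least element. -/
theorem exists_degree_bound [SemilatticeSup P] {Q : Type*} [SemilatticeSup Q] {φ : P → Q}
    (hφ : ∀ a b, φ (a ⊔ b) = φ a ⊔ φ b) {ι : Type*} {deg : ι → P} {a' : Q} {x : ι →₀ k}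
    (hx : x ∈ degLE k (φ ∘ deg) a') (h0 : x ≠ 0) :
    ∃ a, φ a ≤ a' ∧ x ∈ degLE k deg a := by
  have hne : x.support.Nonempty := Finsupp.support_nonempty_iff.2 h0
  refine ⟨x.support.sup' hne deg, ?_, mem_degLE.2 fun j hj =>
    Finset.le_sup' deg (Finsupp.mem_support_iff.2 hj)⟩
  rw [Finset.apply_sup'_eq_sup'_comp hne φ hφ]
  exact Finset.sup'_le _ _ fun j hj => mem_degLE.1 hx j (Finsupp.mem_support_iff.1 hj)

theorem degLE_comp_le [SemilatticeSup P] {Q : Type*} [SemilatticeSup Q] {φ : P → Q}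
    (hφ : ∀ a b, φ (a ⊔ b) = φ a ⊔ φ b) {ι : Type*} {deg : ι → P} {a : P} {a' : Q}
    (ha : φ a ≤ a') : degLE k deg a ≤ degLE k (φ ∘ deg) a' := by
  intro x hx
  refine mem_degLE.2 fun j hj => le_trans ?_ ha
  have h := hφ (deg j) a
  rw [sup_eq_right.2 (mem_degLE.1 hx j hj)] at h
  exact sup_eq_right.1 h.symm

/-- Relabeling along a map of degrees that preserves joins. -/
theorem IsFilteredResolution.map [SemilatticeSup P] {Q : Type*} [SemilatticeSup Q] {φ : P → Q}
    (hφ : ∀ a b, φ (a ⊔ b) = φ a ⊔ φ b) {ι : ℕ → Type*} {deg : ∀ i, ι i → P}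
    {L : ∀ i, (ι (i + 1) →₀ k) →ₗ[k] (ι i →₀ k)} {aug : (ι 0 →₀ k) →ₗ[k] k} {U : Set P}
    (h : IsFilteredResolution deg L aug U) :
    IsFilteredResolution (fun i => φ ∘ deg i) L aug {a' | ∃ a ∈ U, φ a ≤ a'} where
  filtered i j := degLE_comp_le hφ le_rfl (h.filtered i j)
  mem_cycles := h.mem_cycles
  exact i a' x hx hc := by
    rcases eq_or_ne x 0 with rfl | h0
    · exact ⟨0, zero_mem _, map_zero _⟩
    · obtain ⟨a, ha, hxa⟩ := exists_degree_bound hφ hx h0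
      obtain ⟨y, hy, rfl⟩ := h.exact i a x hxa hc
      exact ⟨y, degLE_comp_le hφ ha hy, rfl⟩
  aug_iff a' := by
    constructor
    · rintro ⟨a, ha, haa⟩
      obtain ⟨x, hx, h1⟩ := (h.aug_iff a).1 ha
      exact ⟨x, degLE_comp_le hφ haa hx, h1⟩
    · rintro ⟨x, hx, h1⟩
      obtain ⟨a, ha, hxa⟩ := exists_degree_bound hφ hx (by rintro rfl; simp at h1)
      exact ⟨a, (h.aug_iff a).2 ⟨x, hxa, h1⟩, ha⟩

/-! ### Comparison of filtered resolutions -/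

/-- The differential decreases degrees strictly. -/
def IsStrict {ι : ℕ → Type*} (deg : ∀ i, ι i → P)
    (L : ∀ i, (ι (i + 1) →₀ k) →ₗ[k] (ι i →₀ k)) : Prop :=
  ∀ i j l, deg i l = deg (i + 1) j → L i (Finsupp.single j 1) l = 0

/-- Dependent choice with types that vary with the index. Chain maps, homotopies and resolutions are
built with it, `Good` being the invariant that makes the next step possible. -/
theorem exists_dependent_seq {X : ℕ → Type*} {Good : ∀ i, X i → Prop}
    {R : ∀ i, X i → X (i + 1) → Prop} (h0 : ∃ x, Good 0 x)
    (hs : ∀ i x, Good i x → ∃ y, Good (i + 1) y ∧ R i x y) :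
    ∃ s : ∀ i, X i, Good 0 (s 0) ∧ ∀ i, Good i (s i) ∧ R i (s i) (s (i + 1)) := by
  obtain ⟨x0, hx0⟩ := h0
  choose g hg1 hg2 using hs
  let s : ∀ i, {x : X i // Good i x} := fun i =>
    Nat.rec (motive := fun i => {x : X i // Good i x}) ⟨x0, hx0⟩
      (fun i x => ⟨g i x.1 x.2, hg1 i x.1 x.2⟩) i
  exact ⟨fun i => (s i).1, (s 0).2, fun i => ⟨(s i).2, hg2 i (s i).1 (s i).2⟩⟩

section Comparison

variable [Preorder P] {ι κ : ℕ → Type*} {deg : ∀ i, ι i → P} {deg' : ∀ i, κ i → P}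
  {L : ∀ i, (ι (i + 1) →₀ k) →ₗ[k] (ι i →₀ k)} {L' : ∀ i, (κ (i + 1) →₀ k) →ₗ[k] (κ i →₀ k)}
  {aug : (ι 0 →₀ k) →ₗ[k] k} {aug' : (κ 0 →₀ k) →ₗ[k] k} {U : Set P}

/-- Graded projectivity: exactness in the degree of each basis vector gives a preimage that does not
exceed this degree. -/
theorem IsFilteredResolution.exists_lift (h : IsFilteredResolution deg' L' aug' U) (i : ℕ)
    {l : Type*} {degl : l → P} {f : (l →₀ k) →ₗ[k] (κ i →₀ k)} (hf : IsFiltered degl (deg' i) f)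
    (hc : ∀ x, f x ∈ augCycles L' aug' i) :
    ∃ g : (l →₀ k) →ₗ[k] (κ (i + 1) →₀ k), IsFiltered degl (deg' (i + 1)) g ∧ L' i ∘ₗ g = f := by
  choose y hy1 hy2 using fun j => h.exact i (degl j) _ (hf j) (hc (Finsupp.single j 1))
  refine ⟨Finsupp.linearCombination k y, fun j => ?_, Finsupp.lhom_ext' fun j =>
    LinearMap.ext_ring ?_⟩
  · simpa using hy1 j
  · simp [hy2]

theorem IsFilteredResolution.exists_chainMap (h : IsFilteredResolution deg L aug U)
    (h' : IsFilteredResolution deg' L' aug' U) :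
    ∃ f : ∀ i, (ι i →₀ k) →ₗ[k] (κ i →₀ k), (∀ i, IsFiltered (deg i) (deg' i) (f i)) ∧
      aug' ∘ₗ f 0 = aug ∧ ∀ i, L' i ∘ₗ f (i + 1) = f i ∘ₗ L i := by
  have base : ∃ f : (ι 0 →₀ k) →ₗ[k] (κ 0 →₀ k), IsFiltered (deg 0) (deg' 0) f ∧
      aug' ∘ₗ f = aug := by
    -- A basis vector with nonzero augmentation forces its degree into `U`, so the other resolution
    -- also has a vector of that filtration degree with nonzero augmentation; it only has to be
    -- rescaled.
    have : ∀ j, ∃ y ∈ degLE k (deg' 0) (deg 0 j), aug' y = aug (Finsupp.single j 1) := by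
      intro j
      by_cases h0 : aug (Finsupp.single j 1) = 0
      · exact ⟨0, zero_mem _, by simp [h0]⟩
      · obtain ⟨y, hy, hy0⟩ := (h'.aug_iff _).1
          ((h.aug_iff _).2 ⟨_, single_mem_degLE le_rfl 1, h0⟩)
        exact ⟨(aug (Finsupp.single j 1) / aug' y) • y, Submodule.smul_mem _ _ hy, by
          simp [div_mul_cancel₀ _ hy0]⟩
    choose y hy1 hy2 using this
    refine ⟨Finsupp.linearCombination k y, fun j => ?_, Finsupp.lhom_ext' fun j =>
      LinearMap.ext_ring ?_⟩
    · simpa using hy1 j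
    · simp [hy2]
  obtain ⟨f, hf0, hf⟩ := exists_dependent_seq
    (X := fun i => (ι i →₀ k) →ₗ[k] (κ i →₀ k))
    (Good := fun i f => IsFiltered (deg i) (deg' i) f ∧ (∀ y, f (L i y) ∈ augCycles L' aug' i) ∧
      -- Compatibility with the augmentations only has a meaning in homological degree `0`, hence
      -- the transport along `hi`.
      ∀ (hi : i = 0), aug' ∘ₗ (hi ▸ f) = aug)
    (R := fun i f g => L' i ∘ₗ g = f ∘ₗ L i) (by
      obtain ⟨f, hf, hfa⟩ := base
      refine ⟨f, hf, fun y => ?_, fun _ => hfa⟩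
      change aug' (f (L 0 y)) = 0
      rw [← LinearMap.comp_apply, hfa]
      exact h.mem_cycles 0 y) (by
      rintro i f ⟨hf, hc, -⟩
      obtain ⟨g, hg, hgf⟩ := h'.exists_lift i (hf.comp (h.filtered i)) hc
      refine ⟨g, ⟨hg, fun y => ?_, fun hi => absurd hi (Nat.succ_ne_zero i)⟩, hgf⟩
      change L' i (g (L (i + 1) y)) = 0
      rw [← LinearMap.comp_apply, hgf, LinearMap.comp_apply]
      have : L i (L (i + 1) y) = 0 := h.mem_cycles (i + 1) y
      rw [this, map_zero])
  exact ⟨f, fun i => (hf i).1.1, hf0.2.2 rfl, fun i => (hf i).2⟩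

theorem IsFilteredResolution.exists_homotopy (h : IsFilteredResolution deg L aug U)
    {D : ∀ i, (ι i →₀ k) →ₗ[k] (ι i →₀ k)} (hD : ∀ i, IsFiltered (deg i) (deg i) (D i))
    (hD0 : aug ∘ₗ D 0 = 0) (hDL : ∀ i, L i ∘ₗ D (i + 1) = D i ∘ₗ L i) :
    ∃ s : ∀ i, (ι i →₀ k) →ₗ[k] (ι (i + 1) →₀ k),
      (∀ i, IsFiltered (deg i) (deg (i + 1)) (s i)) ∧ L 0 ∘ₗ s 0 = D 0 ∧
      ∀ i, L (i + 1) ∘ₗ s (i + 1) = D (i + 1) - s i ∘ₗ L i := by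
  obtain ⟨s, hs0, hs⟩ := exists_dependent_seq
    (X := fun i => (ι i →₀ k) →ₗ[k] (ι (i + 1) →₀ k))
    -- The relation `L s L = D L` says exactly that `D - s L` in the next degree takes values in
    -- cycles, so that it can be lifted.
    (Good := fun i s => IsFiltered (deg i) (deg (i + 1)) s ∧ L i ∘ₗ s ∘ₗ L i = D i ∘ₗ L i ∧
      ∀ (hi : i = 0), L 0 ∘ₗ (hi ▸ s) = D 0)
    (R := fun i s t => L (i + 1) ∘ₗ t = D (i + 1) - s ∘ₗ L i) (by
      obtain ⟨s, hs, hs0⟩ := h.exists_lift 0 (hD 0) (fun x => LinearMap.congr_fun hD0 x)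
      exact ⟨s, hs, by rw [← LinearMap.comp_assoc, hs0], fun _ => hs0⟩) (by
      rintro i s ⟨hs, hc, -⟩
      obtain ⟨t, ht, hts⟩ := h.exists_lift (i + 1) ((hD (i + 1)).sub (hs.comp (h.filtered i)))
        (fun x => by
          change L i _ = 0
          have h1 := LinearMap.congr_fun hc x
          have h2 := LinearMap.congr_fun (hDL i) x
          simp only [LinearMap.comp_apply] at h1 h2
          simp [h1, h2])
      refine ⟨t, ⟨ht, LinearMap.ext fun x => ?_, fun hi => absurd hi (Nat.succ_ne_zero i)⟩, hts⟩
      have h1 := LinearMap.congr_fun hts (L (i + 1) x)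
      have h2 : L i (L (i + 1) x) = 0 := h.mem_cycles (i + 1) x
      simpa [h2] using h1)
  exact ⟨s, fun i => (hs i).1.1, hs0.2.2 rfl, fun i => (hs i).2⟩

/-- A filtered endomorphism of a minimal resolution that is homotopic to zero vanishes on the
associated graded spaces. -/
theorem IsFilteredResolution.apply_eq_zero_of_chainMap {P : Type*} [PartialOrder P] {U : Set P}
    {deg : ∀ i, ι i → P} (h : IsFilteredResolution deg L aug U) (hL : IsStrict deg L)
    {D : ∀ i, (ι i →₀ k) →ₗ[k] (ι i →₀ k)} (hD : ∀ i, IsFiltered (deg i) (deg i) (D i))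
    (hD0 : aug ∘ₗ D 0 = 0) (hDL : ∀ i, L i ∘ₗ D (i + 1) = D i ∘ₗ L i) (i : ℕ) (j j' : ι i)
    (hj : deg i j' = deg i j) : D i (Finsupp.single j 1) j' = 0 := by
  obtain ⟨s, hs, hs0, hsL⟩ := h.exists_homotopy hD hD0 hDL
  -- A strict differential cannot reach a generator from chains of degree at most that of the
  -- generator. This kills the summand `L s` of `D`.
  have key : ∀ i (x : ι (i + 1) →₀ k) (j' : ι i), x ∈ degLE k (deg (i + 1)) (deg i j') →
      L i x j' = 0 := by
    intro i x j' hx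
    rw [linearMap_finsupp_apply, Finsupp.sum, Finsupp.finsetSum_apply]
    refine Finset.sum_eq_zero fun l hl => ?_
    rw [Finsupp.smul_apply]
    by_cases h0 : L i (Finsupp.single l 1) j' = 0
    · rw [h0, smul_zero]
    · have h1 := mem_degLE.1 (h.filtered i l) j' h0
      have h2 := mem_degLE.1 hx l (Finsupp.mem_support_iff.1 hl)
      rw [hL i l j' (le_antisymm h1 h2), smul_zero]
  cases i with
  | zero =>
    rw [← hs0]
    exact key 0 _ _ (hj ▸ hs 0 j)
  | succ i =>
    have h1 : D (i + 1) = L (i + 1) ∘ₗ s (i + 1) + s i ∘ₗ L i := by rw [hsL]; abel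
    rw [h1, LinearMap.add_apply, Finsupp.add_apply, LinearMap.comp_apply, LinearMap.comp_apply,
      key (i + 1) _ _ (hj ▸ hs (i + 1) j), zero_add, linearMap_finsupp_apply, Finsupp.sum,
      Finsupp.finsetSum_apply]
    refine Finset.sum_eq_zero fun l hl => ?_
    rw [Finsupp.smul_apply]
    -- In the summand `s L`, a nonzero term passes through some `l` with `deg l` squeezed between
    -- equal degrees, which strictness forbids.
    by_contra h0
    have h2 := mem_degLE.1 (hs i l) j' fun h => h0 (by rw [h, smul_zero])
    have hl0 := Finsupp.mem_support_iff.1 hl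
    have h3 := mem_degLE.1 (h.filtered i j) l hl0
    exact hl0 (hL i j l (le_antisymm h3 (hj ▸ h2)))

end Comparison

/-- A minimal resolution has at most as many generators in each degree as any other one. -/
theorem IsFilteredResolution.fiber_embedding [PartialOrder P] {ι κ : ℕ → Type u}
    {deg : ∀ i, ι i → P} {deg' : ∀ i, κ i → P}
    {L : ∀ i, (ι (i + 1) →₀ k) →ₗ[k] (ι i →₀ k)} {L' : ∀ i, (κ (i + 1) →₀ k) →ₗ[k] (κ i →₀ k)}
    {aug : (ι 0 →₀ k) →ₗ[k] k} {aug' : (κ 0 →₀ k) →ₗ[k] k} {U : Set P}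
    (h : IsFilteredResolution deg L aug U) (hL : IsStrict deg L)
    (h' : IsFilteredResolution deg' L' aug' U) (i : ℕ) (a : P) :
    Nonempty ({j // deg i j = a} ↪ {j // deg' i j = a}) := by
  classical
  obtain ⟨f, hf, hf0, hfL⟩ := h.exists_chainMap h'
  obtain ⟨g, hg, hg0, hgL⟩ := h'.exists_chainMap h
  have hD := h.apply_eq_zero_of_chainMap hL (D := fun i => g i ∘ₗ f i - LinearMap.id)
    (fun i => ((hg i).comp (hf i)).sub IsFiltered.id)
    (by rw [LinearMap.comp_sub, ← LinearMap.comp_assoc, hg0, hf0, LinearMap.comp_id, sub_self])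
    (fun i => by
      rw [LinearMap.comp_sub, ← LinearMap.comp_assoc, hgL, LinearMap.comp_assoc, hfL,
        LinearMap.sub_comp]
      rfl) i
  let F : ({j // deg i j = a} →₀ k) →ₗ[k] ({j // deg' i j = a} →₀ k) :=
    (Finsupp.lcomapDomain _ Subtype.val_injective) ∘ₗ f i ∘ₗ Finsupp.lmapDomain k k Subtype.val
  let G : ({j // deg' i j = a} →₀ k) →ₗ[k] ({j // deg i j = a} →₀ k) :=
    (Finsupp.lcomapDomain _ Subtype.val_injective) ∘ₗ g i ∘ₗ Finsupp.lmapDomain k k Subtype.val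
  have hGF : G ∘ₗ F = LinearMap.id := by
    refine Finsupp.lhom_ext' fun j => LinearMap.ext_ring (Finsupp.ext fun j' => ?_)
    have h1 := hD j.1 j'.1 (j'.2.trans j.2.symm)
    rw [LinearMap.sub_apply, Finsupp.sub_apply, sub_eq_zero, LinearMap.comp_apply] at h1
    simp only [LinearMap.comp_apply, LinearMap.id_apply, Finsupp.lsingle_apply]
    -- Between generators of degree `a`, the composite `g f` only passes through generators of
    -- degree `a`: `f` bounds the intermediate degree from above and `g` from below.
    have h2 : g i (Finsupp.mapDomain Subtype.val (F (Finsupp.single j 1))) j'.1 =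
        g i (f i (Finsupp.single j.1 1)) j'.1 := by
      rw [← sub_eq_zero, ← Finsupp.sub_apply, ← map_sub, linearMap_finsupp_apply, Finsupp.sum,
        Finsupp.finsetSum_apply]
      refine Finset.sum_eq_zero fun l hl => ?_
      rw [Finsupp.smul_apply]
      by_contra h0
      have h3 := mem_degLE.1 (hg i l) j'.1 fun h => h0 (by rw [h, smul_zero])
      have hl0 := Finsupp.mem_support_iff.1 hl
      rw [Finsupp.sub_apply] at hl0
      by_cases hla : deg' i l = a
      · refine hl0 (sub_eq_zero.2 ?_)
        have h4 := Finsupp.mapDomain_apply (M := k) (Subtype.val_injective (p := fun l => deg' i l = a))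
          (F (Finsupp.single j 1)) ⟨l, hla⟩
        refine h4.trans ?_
        simp [F, Finsupp.lcomapDomain, Finsupp.comapDomain_apply]
      · rw [Finsupp.mapDomain_of_notMem_range _ _ (by simpa using hla), zero_sub, neg_ne_zero] at hl0
        have h5 := mem_degLE.1 (hf i j.1) l hl0
        rw [j.2] at h5
        rw [j'.2] at h3
        exact hla (le_antisymm h5 h3)
    have h6 : G (F (Finsupp.single j 1)) j' =
        g i (Finsupp.mapDomain Subtype.val (F (Finsupp.single j 1))) j'.1 := rfl
    rw [h6, h2, h1, LinearMap.id_apply, Finsupp.single_apply, Finsupp.single_apply]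
    simp [Subtype.ext_iff]
  have hinj : Function.Injective F := by
    refine Function.LeftInverse.injective (g := G) fun x => ?_
    exact LinearMap.congr_fun hGF x
  -- Ranks are compared as cardinals, so the index sets may be infinite.
  have hr := LinearMap.rank_le_of_injective F hinj
  rw [rank_finsupp_self', rank_finsupp_self'] at hr
  exact Cardinal.le_def _ _ |>.1 hr

end Filtered

/-! ### Existence of minimal filtered resolutions -/

section Existence

variable {k : Type u} [Field k] {P : Type} [PartialOrder P]

/-- New generators in degree `a` are a basis of a complement `C a` of `B a`, the sum of the `K b`
with `b < a`. The hypothesis `hA` says that nothing new appears outside the finite set `A`. The last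
clause is minimality: a relation of degree `a` does not involve generators of degree `a`. -/
theorem exists_minimal_cover {V : Type*} [AddCommGroup V] [Module k V] [FiniteDimensional k V]
    (K : P → Submodule k V) (hK : Monotone K) (A : Finset P)
    (hA : ∀ a, K a = ⊥ ∨ ∃ b ∈ A, b ≤ a ∧ K a ≤ K b) :
    ∃ (ι : Type u) (deg : ι → P) (L : (ι →₀ k) →ₗ[k] V), Finite ι ∧ (∀ j, deg j ∈ A) ∧
      (∀ a, (degLE k deg a).map L = K a) ∧
      ∀ a x, x ∈ degLE k deg a → L x = 0 → ∀ j, deg j = a → x j = 0 := by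
  classical
  let B : P → Submodule k V := fun a => ⨆ (b : P) (_ : b < a), K b
  have hBK : ∀ a, B a ≤ K a := fun a => iSup₂_le fun b hb => hK hb.le
  have hC : ∀ a, ∃ C : Submodule k V, B a ⊔ C = K a ∧ Disjoint (B a) C := by
    intro a
    obtain ⟨C, hC⟩ := exists_isCompl (B a)
    exact ⟨C ⊓ K a, by rw [← sup_inf_assoc_of_le _ (hBK a), hC.sup_eq_top, top_inf_eq],
      hC.disjoint.mono_right inf_le_left⟩
  choose C hCK hCd using hC
  have hCle : ∀ a, C a ≤ K a := fun a => hCK a ▸ le_sup_right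
  let v : (Σ a : A, Fin (Module.finrank k (C a))) → V := fun p =>
    (Module.finBasis k (C p.1) p.2 : V)
  have hv : ∀ p, v p ∈ C p.1 := fun p => (Module.finBasis k (C p.1) p.2).2
  let ι := ULift.{u} (Σ a : A, Fin (Module.finrank k (C a)))
  let deg : ι → P := fun j => j.down.1
  let L : (ι →₀ k) →ₗ[k] V := Finsupp.linearCombination k fun j => v j.down
  have hL1 : ∀ j, L (Finsupp.single j 1) = v j.down := fun j => by simp [L]
  have hvK : ∀ j : ι, v j.down ∈ K (deg j) := fun j => hCle _ (hv j.down)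
  refine ⟨ι, deg, L, inferInstance, fun j => j.down.1.2, fun a => le_antisymm ?_ ?_, ?_⟩
  · rw [Submodule.map_le_iff_le_comap]
    intro x hx
    rw [Submodule.mem_comap, linearMap_finsupp_apply]
    refine sum_mem fun j hj => Submodule.smul_mem _ _ ?_
    rw [hL1]
    exact hK (mem_degLE.1 hx j (Finsupp.mem_support_iff.1 hj)) (hvK j)
  -- Induction along the order of the finite set `A`: `B a` is covered by smaller degrees, `C a` by
  -- its basis.
  · have key : ∀ a : A, K a ≤ (degLE k deg a).map L := by
      intro a
      induction a using WellFoundedLT.induction with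
      | ind a ih =>
        rw [← hCK]
        refine sup_le (iSup₂_le fun b hb => ?_) fun x hx => ?_
        · rcases hA b with h0 | ⟨c, hc, hcb, hbc⟩
          · rw [h0]; exact bot_le
          · exact (hbc.trans (ih ⟨c, hc⟩ (show c < a.1 from lt_of_le_of_lt hcb hb))).trans
              (Submodule.map_mono (degLE_mono (hcb.trans hb.le)))
        · have h1 := (Module.finBasis k (C a)).sum_repr ⟨x, hx⟩
          have h2 : _ = x := congrArg Subtype.val h1
          rw [AddSubmonoidClass.coe_finsetSum] at h2
          rw [← h2]
          refine sum_mem fun i _ => ?_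
          exact Submodule.smul_mem _ _
            ⟨Finsupp.single (ULift.up ⟨a, i⟩) 1, single_mem_degLE le_rfl 1, hL1 _⟩
    rcases hA a with h0 | ⟨b, hb, hba, hab⟩
    · rw [h0]; exact bot_le
    · exact (hab.trans (key ⟨b, hb⟩)).trans (Submodule.map_mono (degLE_mono hba))
  · rintro a x hx hLx ⟨⟨⟨a', ha'⟩, i⟩⟩ rfl
    change x ∈ degLE k deg a' at hx
    let c : Fin (Module.finrank k (C a')) → k := fun i => x (ULift.up ⟨⟨a', ha'⟩, i⟩)
    -- The component of `x` of degree `a'`. Its image lies in `C a'`, and also in `B a'` since `L x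
    -- = 0` and the other components have smaller degree; so the image vanishes.
    let y : ι →₀ k := ∑ i, Finsupp.single (ULift.up ⟨⟨a', ha'⟩, i⟩) (c i)
    have hy : ∀ l, deg l = a' → y l = x l := by
      rintro ⟨⟨⟨b, hb⟩, l⟩⟩ hba
      change b = a' at hba
      subst hba
      simp only [y, Finsupp.finsetSum_apply]
      rw [Finset.sum_eq_single l]
      · simp [c]
      · intro i' _ hi'
        rw [Finsupp.single_eq_of_ne]
        intro h
        cases h
        exact hi' rfl
      · simp
    have hy' : ∀ l, deg l ≠ a' → y l = 0 := by
      intro l hl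
      simp only [y, Finsupp.finsetSum_apply]
      refine Finset.sum_eq_zero fun i _ => ?_
      rw [Finsupp.single_eq_of_ne]
      rintro rfl
      exact hl rfl
    have hLy : L y = ∑ i, c i • (Module.finBasis k (C a') i : V) := by
      simp only [y, map_sum]
      refine Finset.sum_congr rfl fun i _ => ?_
      simp [L, v]
    have hyC : L y ∈ C a' := by
      rw [hLy]
      exact sum_mem fun i _ => Submodule.smul_mem _ _ (Module.finBasis k (C a') i).2
    have hyB : L y ∈ B a' := by
      have h1 : L y = -L (x - y) := by rw [map_sub, hLx]; simp
      rw [h1, linearMap_finsupp_apply]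
      refine neg_mem (sum_mem fun l hl => Submodule.smul_mem _ _ ?_)
      rw [hL1]
      have hl0 := Finsupp.mem_support_iff.1 hl
      rw [Finsupp.sub_apply] at hl0
      have hne : deg l ≠ a' := fun h => hl0 (by rw [hy l h, sub_self])
      rw [hy' l hne, sub_zero] at hl0
      exact (le_iSup₂ (f := fun (b : P) (_ : b < a') => K b) (deg l)
        (lt_of_le_of_ne (mem_degLE.1 hx l hl0) hne)) (hvK l)
    have h0 : L y = 0 := (Submodule.disjoint_def.1 (hCd a')) _ hyB hyC
    rw [hLy] at h0
    have h1 : ∑ i, c i • Module.finBasis k (C a') i = 0 := by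
      apply Subtype.val_injective
      rw [AddSubmonoidClass.coe_finsetSum]
      exact h0
    exact Fintype.linearIndependent_iff.1 (Module.finBasis k (C a')).linearIndependent c h1 i

/-- A based filtered vector space with a subspace of cycles. -/
structure FilteredStage (k : Type u) [Field k] (P : Type) where
  ι : Type u
  deg : ι → P
  Z : Submodule k (ι →₀ k)

/-- The degrees lie in `A`, and cycles of degree `a` have no components of degree `a`. -/
def FilteredStage.IsMinimalIn (X : FilteredStage k P) (A : Finset P) : Prop :=
  Finite X.ι ∧ (∀ j, X.deg j ∈ A) ∧
    ∀ a, ∀ x ∈ degLE k X.deg a, x ∈ X.Z → ∀ j, X.deg j = a → x j = 0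

/-- Minimal resolutions whose generators have degrees in `A`. -/
theorem exists_minimal_filteredResolution {P : Type} [Lattice P] {U : Set P} {A : Finset P}
    (hsup : ∀ a ∈ A, ∀ b ∈ A, a ⊔ b ∈ A) (hU : IsUpperSet U)
    (hUA : ∀ a ∈ U, ∃ b ∈ A, b ≤ a ∧ b ∈ U) :
    ∃ (ι : ℕ → Type u) (deg : ∀ i, ι i → P) (L : ∀ i, (ι (i + 1) →₀ k) →ₗ[k] (ι i →₀ k))
      (aug : (ι 0 →₀ k) →ₗ[k] k), IsFilteredResolution deg L aug U ∧ IsStrict deg L ∧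
      (∀ i, Finite (ι i)) ∧ ∀ i j, deg i j ∈ A := by
  classical
  obtain ⟨s, hs0, hs⟩ := exists_dependent_seq
    (X := fun _ => FilteredStage k P)
    (Good := fun i X => X.IsMinimalIn A ∧ (i = 0 → ∃ aug : (X.ι →₀ k) →ₗ[k] k,
      X.Z = LinearMap.ker aug ∧ ∀ a, (degLE k X.deg a).map aug = if a ∈ U then ⊤ else ⊥))
    (R := fun _ X Y => ∃ L : (Y.ι →₀ k) →ₗ[k] (X.ι →₀ k),
      Y.Z = LinearMap.ker L ∧ ∀ a, (degLE k Y.deg a).map L = X.Z ⊓ degLE k X.deg a) (by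
      obtain ⟨ι, deg, L, h1, h2, h3, h4⟩ := exists_minimal_cover (k := k) (V := k)
        (fun a : P => if a ∈ U then ⊤ else ⊥) (by
          intro a b hab
          dsimp only
          split_ifs with ha hb
          · exact le_rfl
          · exact absurd (hU hab ha) hb
          · exact bot_le
          · exact le_rfl) A (by
          intro a
          by_cases ha : a ∈ U
          · obtain ⟨b, hb, hba, hbU⟩ := hUA a ha
            exact Or.inr ⟨b, hb, hba, fun x _ => if_pos hbU ▸ Submodule.mem_top⟩
          · exact Or.inl (if_neg ha))
      exact ⟨⟨ι, deg, LinearMap.ker L⟩, ⟨h1, h2, fun a x hx hxZ => h4 a x hx hxZ⟩,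
        fun _ => ⟨L, rfl, h3⟩⟩) (by
      rintro i X ⟨⟨hfin, hdeg, hmin⟩, -⟩
      obtain ⟨ι, deg, L, h1, h2, h3, h4⟩ := exists_minimal_cover (k := k)
        (fun a : P => X.Z ⊓ degLE k X.deg a)
        (fun a b hab => inf_le_inf_left _ (degLE_mono hab)) A (by
          intro a
          -- Cycles only have components with degrees in `A`. As `A` is closed under joins, the
          -- cycles of degree at most `a` are those of degree at most the largest element of `A`
          -- below `a`.
          by_cases hne : (A.filter (· ≤ a)).Nonempty
          · refine Or.inr ⟨(A.filter (· ≤ a)).sup' hne id, ?_, ?_, ?_⟩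
            · exact Finset.sup'_mem (A : Set P) hsup _ hne id
                fun b hb => (Finset.mem_filter.1 hb).1
            · exact Finset.sup'_le _ _ fun b hb => (Finset.mem_filter.1 hb).2
            · refine inf_le_inf_left _ fun x hx => mem_degLE.2 fun j hj => ?_
              exact Finset.le_sup' id (Finset.mem_filter.2 ⟨hdeg j, mem_degLE.1 hx j hj⟩)
          · refine Or.inl (eq_bot_iff.2 fun x hx => ?_)
            refine (Submodule.mem_bot k).2 (Finsupp.ext fun j => ?_)
            by_contra hj
            exact hne ⟨X.deg j, Finset.mem_filter.2 ⟨hdeg j, mem_degLE.1 hx.2 j hj⟩⟩)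
      exact ⟨⟨ι, deg, LinearMap.ker L⟩, ⟨⟨h1, h2, fun a x hx hxZ => h4 a x hx hxZ⟩,
        fun hi => absurd hi (Nat.succ_ne_zero i)⟩, L, rfl, h3⟩)
  obtain ⟨aug, haugZ, haug⟩ := hs0.2 rfl
  choose L hLZ hL using fun i => (hs i).2
  have hcyc : ∀ i, augCycles (ι := fun i => (s i).ι) L aug i = (s i).Z := by
    intro i
    cases i with
    | zero => exact haugZ.symm
    | succ i => exact (hLZ i).symm
  have hmem : ∀ i j, L i (Finsupp.single j 1) ∈
      (s i).Z ⊓ degLE k (s i).deg ((s (i + 1)).deg j) := fun i j =>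
    hL i _ ▸ Submodule.mem_map_of_mem (single_mem_degLE le_rfl 1)
  refine ⟨fun i => (s i).ι, fun i => (s i).deg, L, aug, ⟨fun i j => (hmem i j).2, fun i y => ?_,
    fun i a x hx hc => ?_, fun a => ?_⟩, fun i j l hl => ?_, fun i => (hs i).1.1.1,
    fun i => (hs i).1.1.2.1⟩
  · rw [hcyc, linearMap_finsupp_apply]
    exact sum_mem fun j _ => Submodule.smul_mem _ _ (hmem i j).1
  · rw [hcyc] at hc
    have : x ∈ (degLE k (s (i + 1)).deg a).map (L i) := by rw [hL]; exact ⟨hc, hx⟩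
    exact this
  · have h1 := haug a
    by_cases ha : a ∈ U
    · simp only [ha, if_true, true_iff] at h1 ⊢
      obtain ⟨x, hx, hx1⟩ := h1.symm ▸ Submodule.mem_top (R := k) (x := (1 : k))
      exact ⟨x, hx, by rw [hx1]; exact one_ne_zero⟩
    · simp only [ha, if_false, false_iff] at h1 ⊢
      rintro ⟨x, hx, hx1⟩
      exact hx1 ((Submodule.mem_bot k).1 (h1 ▸ Submodule.mem_map_of_mem hx))
  · exact (hs i).1.1.2.2 _ _ (hmem i j).2 (hmem i j).1 l hl

end Existence

/-! ### Multigraded modules with homogeneous bases -/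

section Degrees

variable {σ : Type}

theorem monDeg_add (u v : σ →₀ ℕ) : monDeg (u + v) = monDeg u + monDeg v := by
  ext s; simp [monDeg]

theorem monDeg_nonneg (u : σ →₀ ℕ) : 0 ≤ monDeg u := fun s => by simp [monDeg]

theorem monDeg_injective : Function.Injective (monDeg : (σ →₀ ℕ) → σ → ℤ) := by
  intro u v h
  ext s
  have := congrFun h s
  simpa [monDeg] using this

theorem monDeg_le_monDeg {u v : σ →₀ ℕ} : monDeg u ≤ monDeg v ↔ u ≤ v := by
  simp [Pi.le_def, Finsupp.le_def, monDeg]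

theorem monDeg_sup (u v : σ →₀ ℕ) : monDeg (u ⊔ v) = monDeg u ⊔ monDeg v := by
  ext s; simp [monDeg]

variable [Finite σ]

/-- The exponent vector of a nonnegative multidegree. -/
noncomputable def degExp (a : σ → ℤ) : σ →₀ ℕ :=
  Finsupp.equivFunOnFinite.symm fun s => (a s).toNat

theorem monDeg_degExp {a : σ → ℤ} (h : 0 ≤ a) : monDeg (degExp a) = a := by
  ext s
  simpa [monDeg, degExp] using h s

@[simp]
theorem degExp_monDeg (u : σ →₀ ℕ) : degExp (monDeg u) = u := by
  ext s
  simp [monDeg, degExp]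

theorem degExp_add {a b : σ → ℤ} (ha : 0 ≤ a) (hb : 0 ≤ b) :
    degExp (a + b) = degExp a + degExp b := by
  apply monDeg_injective
  rw [monDeg_add, monDeg_degExp ha, monDeg_degExp hb, monDeg_degExp (add_nonneg ha hb)]

theorem degExp_inj {a b : σ → ℤ} (ha : 0 ≤ a) (hb : 0 ≤ b) : degExp a = degExp b ↔ a = b := by
  refine ⟨fun h => ?_, fun h => by rw [h]⟩
  rw [← monDeg_degExp ha, ← monDeg_degExp hb, h]

end Degrees

/-! ### Homogeneous polynomials and monomials in ideals -/

section StdGrading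

variable {k : Type u} [Field k] {σ : Type}

theorem monomial_mem_stdGrading (u : σ →₀ ℕ) (c : k) {m : σ → ℤ} (h : monDeg u = m) :
    MvPolynomial.monomial u c ∈ stdGrading k σ m :=
  AddSubgroup.subset_closure ⟨u, c, h, rfl⟩

theorem mul_mem_stdGrading {m m' : σ → ℤ} {p p' : MvPolynomial σ k} (hp : p ∈ stdGrading k σ m)
    (hp' : p' ∈ stdGrading k σ m') : p * p' ∈ stdGrading k σ (m + m') := by
  induction hp using AddSubgroup.closure_induction with
  | mem p h =>
    obtain ⟨u, c, rfl, rfl⟩ := h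
    induction hp' using AddSubgroup.closure_induction with
    | mem p' h' =>
      obtain ⟨u', c', rfl, rfl⟩ := h'
      rw [MvPolynomial.monomial_mul]
      exact monomial_mem_stdGrading _ _ (monDeg_add _ _)
    | zero => rw [mul_zero]; exact zero_mem _
    | add x y _ _ hx hy => rw [mul_add]; exact add_mem hx hy
    | neg x _ hx => rw [mul_neg]; exact neg_mem hx
  | zero => rw [zero_mul]; exact zero_mem _
  | add x y _ _ hx hy => rw [add_mul]; exact add_mem hx hy
  | neg x _ hx => rw [neg_mul]; exact neg_mem hx

/-- The basis `1` of the polynomial ring. -/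
noncomputable def unitBasis (k : Type u) [Field k] (σ : Type) :
    Module.Basis PUnit.{u + 1} (MvPolynomial σ k) (MvPolynomial σ k) :=
  Module.Basis.singleton PUnit (MvPolynomial σ k)

theorem isHomogeneousBasis_unitBasis :
    IsHomogeneousBasis (stdGrading k σ) (unitBasis k σ) 0 := by
  intro m
  apply le_antisymm
  · intro p hp
    exact AddSubgroup.subset_closure ⟨PUnit.unit, m, p, hp, add_zero m, by simp [unitBasis]⟩
  · rw [AddSubgroup.closure_le]
    rintro _ ⟨j, a, p, hp, rfl, rfl⟩
    simpa [unitBasis] using hp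

/-- The multidegrees of the monomials in an ideal. -/
def monomialDegrees (J : Ideal (MvPolynomial σ k)) : Set (σ → ℤ) :=
  {a | ∃ v : σ →₀ ℕ, monDeg v = a ∧ MvPolynomial.monomial v 1 ∈ J}

theorem monomial_mem_of_ne_zero {J : Ideal (MvPolynomial σ k)} {v : σ →₀ ℕ} {c : k} (hc : c ≠ 0)
    (h : MvPolynomial.monomial v c ∈ J) (c' : k) : MvPolynomial.monomial v c' ∈ J := by
  have := J.mul_mem_left (MvPolynomial.C (c' / c)) h
  rwa [MvPolynomial.C_mul_monomial, div_mul_cancel₀ _ hc] at this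

end StdGrading

/-! ### Scalar coordinates of homogeneous elements and scalar matrices of graded maps -/

section HomogeneousBasis

variable {k : Type u} [Field k] {σ : Type} [Finite σ]
variable {M : Type*} [AddCommGroup M] [Module (MvPolynomial σ k) M]
variable {N : Type*} [AddCommGroup N] [Module (MvPolynomial σ k) N]
variable {Q : Type*} [AddCommGroup Q] [Module (MvPolynomial σ k) Q]
variable {ι κ l : Type*} (b : Module.Basis ι (MvPolynomial σ k) M) (deg : ι → σ → ℤ)

/-- The element of degree `a` with the given scalar coordinates. -/
noncomputable def homogElem (a : σ → ℤ) : (ι →₀ k) →+ M :=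
  Finsupp.liftAddHom fun j =>
    { toFun := fun z => MvPolynomial.monomial (degExp (a - deg j)) z • b j
      map_zero' := by simp
      map_add' := fun z z' => by rw [map_add, add_smul] }

theorem homogElem_single (a : σ → ℤ) (j : ι) (z : k) :
    homogElem b deg a (Finsupp.single j z) =
      MvPolynomial.monomial (degExp (a - deg j)) z • b j := by
  simp [homogElem]

theorem homogElem_deg_single (j : ι) : homogElem b deg (deg j) (Finsupp.single j 1) = b j := by
  rw [homogElem_single, sub_self]
  have : degExp (0 : σ → ℤ) = 0 := by ext; simp [degExp]
  rw [this]
  exact one_smul _ _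

theorem repr_homogElem (a : σ → ℤ) (c : ι →₀ k) (j : ι) :
    b.repr (homogElem b deg a c) j = MvPolynomial.monomial (degExp (a - deg j)) (c j) := by
  classical
  induction c using Finsupp.induction_linear with
  | zero => simp
  | add f g hf hg => simp [hf, hg]
  | single i z =>
    rw [homogElem_single, map_smul, Module.Basis.repr_self, Finsupp.smul_single, smul_eq_mul,
      mul_one, Finsupp.single_apply, Finsupp.single_apply]
    split_ifs with h
    · rw [h]
    · simp

open Classical in
/-- The scalar coordinates of the homogeneous component of degree `a`. -/
noncomputable def homogCoord (a : σ → ℤ) : M →+ (ι →₀ k) where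
  toFun x := Finsupp.onFinset (b.repr x).support
    (fun j => if deg j ≤ a then MvPolynomial.coeff (degExp (a - deg j)) (b.repr x j) else 0)
    (fun j hj => by
      rw [Finsupp.mem_support_iff]
      intro h
      simp [h] at hj)
  map_zero' := by ext; simp
  map_add' x y := by
    ext j
    simp only [Finsupp.onFinset_apply, Finsupp.add_apply, map_add, MvPolynomial.coeff_add]
    split_ifs <;> simp

open Classical in
theorem homogCoord_apply (a : σ → ℤ) (x : M) (j : ι) : homogCoord b deg a x j =
    if deg j ≤ a then MvPolynomial.coeff (degExp (a - deg j)) (b.repr x j) else 0 :=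
  rfl

theorem homogCoord_mem (a : σ → ℤ) (x : M) : homogCoord b deg a x ∈ degLE k deg a := by
  refine mem_degLE.2 fun j hj => ?_
  by_contra h
  rw [homogCoord_apply, if_neg h] at hj
  exact hj rfl

/-- `degExp` truncates negative entries, so distinct degrees could share an exponent; membership in
`degLE` excludes this. -/
theorem homogCoord_homogElem_of_ne {a a' : σ → ℤ} (ha : a ≠ a') {c : ι →₀ k}
    (hc : c ∈ degLE k deg a') : homogCoord b deg a (homogElem b deg a' c) = 0 := by
  classical
  ext j
  rw [homogCoord_apply, repr_homogElem, MvPolynomial.coeff_monomial, Finsupp.zero_apply]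
  split_ifs with h1 h2
  · by_contra h3
    have h4 := mem_degLE.1 hc j h3
    rw [degExp_inj (sub_nonneg.2 h4) (sub_nonneg.2 h1)] at h2
    exact ha (sub_left_injective h2.symm)
  · rfl
  · rfl

theorem homogCoord_homogElem {a : σ → ℤ} {c : ι →₀ k} (hc : c ∈ degLE k deg a) :
    homogCoord b deg a (homogElem b deg a c) = c := by
  classical
  ext j
  rw [homogCoord_apply, repr_homogElem, MvPolynomial.coeff_monomial, if_pos rfl]
  split_ifs with h1
  · rfl
  · by_contra h3
    exact h1 (mem_degLE.1 hc j (Ne.symm h3))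

theorem homogElem_induction {p : M → Prop} (x : M)
    (homog : ∀ a c, c ∈ degLE k deg a → p (homogElem b deg a c))
    (add : ∀ x y, p x → p y → p (x + y)) : p x := by
  rw [← b.repr.symm_apply_apply x]
  induction b.repr x using Finsupp.induction_linear with
  | zero => simpa using homog 0 0 (zero_mem _)
  | add f g hf hg => rw [map_add]; exact add _ _ hf hg
  | single j q =>
    rw [Module.Basis.repr_symm_apply, Finsupp.linearCombination_single]
    induction q using MvPolynomial.induction_on' with
    | monomial u z =>
      have := homog (monDeg u + deg j) (Finsupp.single j z)
        (single_mem_degLE (le_add_of_nonneg_left (monDeg_nonneg u)) z)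
      rwa [homogElem_single, add_sub_cancel_right, degExp_monDeg] at this
    | add q q' hq hq' => rw [add_smul]; exact add _ _ hq hq'

theorem exists_sum_homogElem (x : M) :
    ∃ T : Finset (σ → ℤ), ∑ a ∈ T, homogElem b deg a (homogCoord b deg a x) = x := by
  classical
  -- Allowing every larger index set lets the sets for two summands be united.
  suffices h : ∃ T : Finset (σ → ℤ), ∀ T', T ⊆ T' →
      ∑ a ∈ T', homogElem b deg a (homogCoord b deg a x) = x by
    obtain ⟨T, hT⟩ := h
    exact ⟨T, hT T subset_rfl⟩
  induction x using homogElem_induction b deg with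
  | homog a c hc =>
    refine ⟨{a}, fun T hT => ?_⟩
    rw [Finset.sum_eq_single a]
    · rw [homogCoord_homogElem b deg hc]
    · intro a' _ ha'
      rw [homogCoord_homogElem_of_ne b deg ha' hc, map_zero]
    · exact fun h => absurd (hT (Finset.mem_singleton_self a)) h
  | add x y hx hy =>
    obtain ⟨T, hT⟩ := hx
    obtain ⟨T', hT'⟩ := hy
    refine ⟨T ∪ T', fun T'' h => ?_⟩
    simp only [map_add, Finset.sum_add_distrib]
    rw [hT _ (Finset.union_subset_left h), hT' _ (Finset.union_subset_right h)]

variable {b deg}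

/-- The strand of degree `a` is a copy of `degLE k deg a`: each basis element of degree at most `a`
occurs with one scalar, times the monomial of the missing degree. -/
theorem closure_smul_basis_eq (b : Module.Basis ι (MvPolynomial σ k) M) (deg : ι → σ → ℤ)
    (a : σ → ℤ) :
    AddSubgroup.closure
      {x | ∃ (j : ι) (a' : σ → ℤ), ∃ p ∈ stdGrading k σ a', a' + deg j = a ∧ x = p • b j} =
    (degLE k deg a).toAddSubgroup.map (homogElem b deg a) := by
  apply le_antisymm
  · rw [AddSubgroup.closure_le]
    rintro _ ⟨j, a', p, hp, rfl, rfl⟩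
    induction hp using AddSubgroup.closure_induction with
    | mem p hp =>
      obtain ⟨u, z, rfl, rfl⟩ := hp
      refine ⟨Finsupp.single j z,
        single_mem_degLE (le_add_of_nonneg_left (monDeg_nonneg u)) z, ?_⟩
      rw [homogElem_single, add_sub_cancel_right, degExp_monDeg]
    | zero => rw [zero_smul]; exact zero_mem _
    | add p q _ _ hp hq => rw [add_smul]; exact add_mem hp hq
    | neg p _ hp => rw [neg_smul]; exact neg_mem hp
  · rintro _ ⟨c, hc, rfl⟩
    rw [← Finsupp.sum_single c, Finsupp.sum, map_sum]
    refine sum_mem fun j hj => AddSubgroup.subset_closure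
      ⟨j, a - deg j, MvPolynomial.monomial (degExp (a - deg j)) (c j), ?_,
        sub_add_cancel _ _, homogElem_single _ _ _ _ _⟩
    exact monomial_mem_stdGrading _ _ (monDeg_degExp (sub_nonneg.2
      (mem_degLE.1 hc j (Finsupp.mem_support_iff.1 hj))))

theorem IsHomogeneousBasis.mem_iff {M : Type u} [AddCommGroup M] [Module (MvPolynomial σ k) M]
    {ι : Type u} {b : Module.Basis ι (MvPolynomial σ k) M} {deg : ι → σ → ℤ}
    {gr : (σ → ℤ) → AddSubgroup M} (h : IsHomogeneousBasis gr b deg)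
    {a : σ → ℤ} {x : M} : x ∈ gr a ↔ ∃ c ∈ degLE k deg a, homogElem b deg a c = x := by
  rw [h a, closure_smul_basis_eq]
  rfl

/-- `L` is the matrix of scalars of the degree-preserving map `f`. -/
structure IsScalarMatrix (b : Module.Basis ι (MvPolynomial σ k) M) (deg : ι → σ → ℤ)
    (b' : Module.Basis κ (MvPolynomial σ k) N) (deg' : κ → σ → ℤ)
    (f : M →ₗ[MvPolynomial σ k] N) (L : (ι →₀ k) →ₗ[k] (κ →₀ k)) : Prop where
  filtered : IsFiltered deg deg' L
  apply_basis : ∀ j, f (b j) = homogElem b' deg' (deg j) (L (Finsupp.single j 1))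

/-- In scalar coordinates, multiplication by a monomial is the inclusion of filtration pieces. -/
theorem monomial_smul_homogElem {a a' : σ → ℤ} (h : a' ≤ a) {c : ι →₀ k}
    (hc : c ∈ degLE k deg a') (z : k) :
    MvPolynomial.monomial (degExp (a - a')) z • homogElem b deg a' c =
      homogElem b deg a (z • c) := by
  apply b.repr.injective
  ext1 j
  rw [map_smul, Finsupp.smul_apply, repr_homogElem, repr_homogElem, smul_eq_mul,
    MvPolynomial.monomial_mul, Finsupp.smul_apply, smul_eq_mul]
  by_cases h0 : c j = 0
  · simp [h0]
  · have h1 := mem_degLE.1 hc j h0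
    rw [← degExp_add (sub_nonneg.2 h) (sub_nonneg.2 h1), sub_add_sub_cancel]

section

variable {b' : Module.Basis κ (MvPolynomial σ k) N} {deg' : κ → σ → ℤ}
  {f : M →ₗ[MvPolynomial σ k] N} {L : (ι →₀ k) →ₗ[k] (κ →₀ k)}

theorem IsScalarMatrix.apply_homogElem (h : IsScalarMatrix b deg b' deg' f L) {a : σ → ℤ}
    {c : ι →₀ k} (hc : c ∈ degLE k deg a) :
    f (homogElem b deg a c) = homogElem b' deg' a (L c) := by
  conv_lhs => rw [← Finsupp.sum_single c]
  rw [linearMap_finsupp_apply L, Finsupp.sum, Finsupp.sum, map_sum, map_sum, map_sum]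
  refine Finset.sum_congr rfl fun j hj => ?_
  rw [homogElem_single, map_smul, h.apply_basis, monomial_smul_homogElem
    (mem_degLE.1 hc j (Finsupp.mem_support_iff.1 hj)) (h.filtered j)]

theorem IsScalarMatrix.homogCoord_apply (h : IsScalarMatrix b deg b' deg' f L) (a : σ → ℤ)
    (x : M) : homogCoord b' deg' a (f x) = L (homogCoord b deg a x) := by
  induction x using homogElem_induction b deg with
  | homog a' c hc =>
    rw [h.apply_homogElem hc]
    rcases eq_or_ne a a' with rfl | ha
    · rw [homogCoord_homogElem _ _ hc, homogCoord_homogElem _ _ (h.filtered.map_mem hc)]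
    · rw [homogCoord_homogElem_of_ne _ _ ha hc,
        homogCoord_homogElem_of_ne _ _ ha (h.filtered.map_mem hc), map_zero]
  | add x y hx hy => simp only [map_add, hx, hy]

theorem IsScalarMatrix.apply_eq_zero_iff (h : IsScalarMatrix b deg b' deg' f L) (x : M) :
    f x = 0 ↔ ∀ a, L (homogCoord b deg a x) = 0 := by
  constructor
  · intro hx a
    rw [← h.homogCoord_apply, hx, map_zero]
  · intro hx
    obtain ⟨T, hT⟩ := exists_sum_homogElem b deg x
    rw [← hT, map_sum]
    refine Finset.sum_eq_zero fun a _ => ?_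
    rw [h.apply_homogElem (homogCoord_mem b deg a x), hx a, map_zero]

/-- An element is the sum of its homogeneous components, on which `f` acts through `L`. Together
with `apply_eq_zero_iff` this reduces exactness to strands. -/
theorem IsScalarMatrix.mem_range_iff (h : IsScalarMatrix b deg b' deg' f L) (x : N) :
    x ∈ LinearMap.range f ↔ ∀ a, ∃ y ∈ degLE k deg a, L y = homogCoord b' deg' a x := by
  constructor
  · rintro ⟨y, rfl⟩ a
    exact ⟨_, homogCoord_mem b deg a y, (h.homogCoord_apply a y).symm⟩
  · intro hx
    obtain ⟨T, hT⟩ := exists_sum_homogElem b' deg' x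
    rw [← hT]
    refine sum_mem fun a _ => ?_
    obtain ⟨y, hy, hyx⟩ := hx a
    exact ⟨homogElem b deg a y, by rw [h.apply_homogElem hy, hyx]⟩

theorem IsScalarMatrix.comp {b'' : Module.Basis l (MvPolynomial σ k) Q} {deg'' : l → σ → ℤ}
    {g : N →ₗ[MvPolynomial σ k] Q} {L' : (κ →₀ k) →ₗ[k] (l →₀ k)}
    (hg : IsScalarMatrix b' deg' b'' deg'' g L') (hf : IsScalarMatrix b deg b' deg' f L) :
    IsScalarMatrix b deg b'' deg'' (g ∘ₗ f) (L' ∘ₗ L) :=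
  ⟨hg.filtered.comp hf.filtered, fun j => by
    rw [LinearMap.comp_apply, hf.apply_basis, hg.apply_homogElem (hf.filtered j)]
    rfl⟩

theorem IsScalarMatrix.eq_zero_iff (h : IsScalarMatrix b deg b' deg' f L) : f = 0 ↔ L = 0 := by
  constructor
  · rintro rfl
    refine Finsupp.lhom_ext' fun j => LinearMap.ext_ring ?_
    have h1 := h.apply_basis j
    rw [LinearMap.zero_apply] at h1
    have h2 := homogCoord_homogElem b' deg' (h.filtered j)
    rw [← h1, map_zero] at h2
    simpa using h2.symm
  · rintro rfl
    exact b.ext fun j => by rw [h.apply_basis]; simp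

end

theorem exists_isScalarMatrix {M N : Type u} [AddCommGroup M] [Module (MvPolynomial σ k) M]
    [AddCommGroup N] [Module (MvPolynomial σ k) N] {ι κ : Type u}
    {b : Module.Basis ι (MvPolynomial σ k) M} {deg : ι → σ → ℤ}
    {b' : Module.Basis κ (MvPolynomial σ k) N} {deg' : κ → σ → ℤ}
    {gr : (σ → ℤ) → AddSubgroup M} {gr' : (σ → ℤ) → AddSubgroup N}
    (hb : IsHomogeneousBasis gr b deg) (hb' : IsHomogeneousBasis gr' b' deg')
    {f : M →ₗ[MvPolynomial σ k] N} (hf : ∀ a x, x ∈ gr a → f x ∈ gr' a) :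
    ∃ L : (ι →₀ k) →ₗ[k] (κ →₀ k), IsScalarMatrix b deg b' deg' f L := by
  have h1 : ∀ j, ∃ c ∈ degLE k deg' (deg j), homogElem b' deg' (deg j) c = f (b j) := fun j =>
    hb'.mem_iff.1 (hf _ _ (hb.mem_iff.2
      ⟨Finsupp.single j 1, single_mem_degLE le_rfl 1, homogElem_deg_single b deg j⟩))
  choose c hc1 hc2 using h1
  exact ⟨Finsupp.linearCombination k c, fun j => by simpa using hc1 j, fun j => by simp [hc2]⟩

theorem IsScalarMatrix.map_mem {M N : Type u} [AddCommGroup M] [Module (MvPolynomial σ k) M]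
    [AddCommGroup N] [Module (MvPolynomial σ k) N] {ι κ : Type u}
    {b : Module.Basis ι (MvPolynomial σ k) M} {deg : ι → σ → ℤ}
    {b' : Module.Basis κ (MvPolynomial σ k) N} {deg' : κ → σ → ℤ}
    {gr : (σ → ℤ) → AddSubgroup M} {gr' : (σ → ℤ) → AddSubgroup N}
    (hb : IsHomogeneousBasis gr b deg) (hb' : IsHomogeneousBasis gr' b' deg')
    {f : M →ₗ[MvPolynomial σ k] N} {L : (ι →₀ k) →ₗ[k] (κ →₀ k)}
    (h : IsScalarMatrix b deg b' deg' f L) (a : σ → ℤ) (x : M) (hx : x ∈ gr a) : f x ∈ gr' a := by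
  obtain ⟨c, hc, rfl⟩ := hb.mem_iff.1 hx
  exact hb'.mem_iff.2 ⟨L c, h.filtered.map_mem hc, (h.apply_homogElem hc).symm⟩

theorem homogElem_unitBasis (a : σ → ℤ) (c : PUnit.{u + 1} →₀ k) :
    homogElem (unitBasis k σ) 0 a c = MvPolynomial.monomial (degExp a) (c PUnit.unit) := by
  have : c = Finsupp.single PUnit.unit (c PUnit.unit) := by ext; simp
  conv_lhs => rw [this]
  rw [homogElem_single]
  simp [unitBasis]

end HomogeneousBasis

/-! ### Multigraded free resolutions and filtered resolutions -/

section Resolution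

variable {k : Type u} [Field k] {σ : Type} [Finite σ]

variable {F : GradedComplex (MvPolynomial σ k) (σ → ℤ)} {J : Ideal (MvPolynomial σ k)}
  {ι : ℕ → Type u} {b : ∀ i, Module.Basis (ι i) (MvPolynomial σ k) (F.X i)}
  {deg : ∀ i, ι i → σ → ℤ}

/-- Dehomogenization: the strand of degree `a` of the resolution becomes the piece `degLE` at `a`,
and that of `J` becomes `k` or `0`. -/
theorem IsMultigradedFreeResolution.exists_filteredResolution
    (hF : IsMultigradedFreeResolution F J)
    (hb : ∀ i, IsHomogeneousBasis (F.gr i) (b i) (deg i)) :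
    ∃ (L : ∀ i, (ι (i + 1) →₀ k) →ₗ[k] (ι i →₀ k)) (aug : (ι 0 →₀ k) →ₗ[k] k),
      (∀ i, IsScalarMatrix (b (i + 1)) (deg (i + 1)) (b i) (deg i) (F.d i) (L i)) ∧
      IsFilteredResolution deg L aug (monomialDegrees J) := by
  obtain ⟨-, hex, ε, hε, hεJ, hεd⟩ := hF
  choose L hL using fun i => exists_isScalarMatrix (hb (i + 1)) (hb i) (F.d_mem i)
  obtain ⟨E, hE⟩ := exists_isScalarMatrix (hb 0) (isHomogeneousBasis_unitBasis) hε
  let aug : (ι 0 →₀ k) →ₗ[k] k := Finsupp.lapply PUnit.unit ∘ₗ E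
  have hE0 : ∀ x, E x = 0 ↔ aug x = 0 := fun x =>
    ⟨fun h => by simp [aug, h], fun h => Finsupp.ext fun _ => h⟩
  have hεd' : ∀ x, ε x = 0 ↔ x ∈ LinearMap.range (F.d 0) := fun x => by
    rw [← hεd, LinearMap.mem_ker]
  refine ⟨L, aug, hL, fun i => (hL i).filtered, fun i y => ?_, fun i a x hx hc => ?_,
    fun a => ?_⟩
  · cases i with
    | zero =>
      refine (hE0 _).1 ?_
      have h1 : ε ∘ₗ F.d 0 = 0 := LinearMap.ext fun x => (hεd' _).2 ⟨x, rfl⟩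
      exact LinearMap.congr_fun ((hE.comp (hL 0)).eq_zero_iff.1 h1) y
    | succ i =>
      exact LinearMap.congr_fun (((hL i).comp (hL (i + 1))).eq_zero_iff.1 (F.d_comp_d i)) y
  · have hr : homogElem (b i) (deg i) a x ∈ LinearMap.range (F.d i) := by
      cases i with
      | zero =>
        rw [← hεd', hE.apply_homogElem hx, (hE0 x).2 hc, map_zero]
      | succ i =>
        refine (hex i _).1 ?_
        have hc' : L i x = 0 := hc
        rw [(hL i).apply_homogElem hx, hc', map_zero]
    obtain ⟨y, hy, hyx⟩ := ((hL i).mem_range_iff _).1 hr a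
    rw [homogCoord_homogElem _ _ hx] at hyx
    exact ⟨y, hy, hyx⟩
  · constructor
    · rintro ⟨v, rfl, hv⟩
      rw [← hεJ] at hv
      obtain ⟨x, hx, hxv⟩ := (hE.mem_range_iff _).1 hv (monDeg v)
      refine ⟨x, hx, fun h0 => ?_⟩
      rw [(hE0 x).2 h0] at hxv
      have := congrArg (fun c : PUnit.{u + 1} →₀ k => c PUnit.unit) hxv
      simp only [homogCoord_apply, unitBasis, monDeg_nonneg, Pi.zero_apply, sub_zero,
        degExp_monDeg, if_true, Module.Basis.singleton_repr, Finsupp.zero_apply] at this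
      classical
      rw [MvPolynomial.coeff_monomial, if_pos rfl] at this
      exact zero_ne_one this
    · rintro ⟨x, hx, hx0⟩
      have h0 : 0 ≤ a := mem_degLE.1 (hE.filtered.map_mem hx) PUnit.unit hx0
      refine ⟨degExp a, monDeg_degExp h0, monomial_mem_of_ne_zero hx0 ?_ 1⟩
      rw [← hεJ]
      exact ⟨homogElem (b 0) (deg 0) a x, by
        rw [hE.apply_homogElem hx, homogElem_unitBasis]; rfl⟩

/-- Homogenization, the converse. The hypothesis `hJ` is needed because the filtered complex only
sees the monomials of `J`. -/
theorem IsFilteredResolution.isMultigradedFreeResolution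
    {L : ∀ i, (ι (i + 1) →₀ k) →ₗ[k] (ι i →₀ k)} {aug : (ι 0 →₀ k) →ₗ[k] k}
    (h : IsFilteredResolution deg L aug (monomialDegrees J))
    (hb : ∀ i, IsHomogeneousBasis (F.gr i) (b i) (deg i))
    (hL : ∀ i, IsScalarMatrix (b (i + 1)) (deg (i + 1)) (b i) (deg i) (F.d i) (L i))
    (hJ : J ≤ Ideal.span {p | ∃ v, p = MvPolynomial.monomial v (1 : k) ∧ p ∈ J}) :
    IsMultigradedFreeResolution F J := by
  refine ⟨fun i => ⟨ι i, b i, deg i, hb i⟩, fun i x => ?_, ?_⟩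
  · rw [(hL i).apply_eq_zero_iff, ← LinearMap.coe_range, SetLike.mem_coe,
      (hL (i + 1)).mem_range_iff]
    refine forall_congr' fun a => ⟨fun h1 => ?_, ?_⟩
    · exact h.exact (i + 1) a _ (homogCoord_mem _ _ _ _) h1
    · rintro ⟨y, hy, hyx⟩
      rw [← hyx]
      exact h.mem_cycles (i + 1) y
  · have haug : ∀ j, aug (Finsupp.single j 1) ≠ 0 →
        ∃ v, monDeg v = deg 0 j ∧ MvPolynomial.monomial v 1 ∈ J := fun j hj =>
      (h.aug_iff (deg 0 j)).2 ⟨_, single_mem_degLE le_rfl 1, hj⟩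
    let E : (ι 0 →₀ k) →ₗ[k] (PUnit.{u + 1} →₀ k) := Finsupp.lsingle PUnit.unit ∘ₗ aug
    -- Where the augmentation is nonzero, `haug` makes the degree that of a monomial of `J`, so
    -- `degExp` truncates nothing there.
    let ε : F.X 0 →ₗ[MvPolynomial σ k] MvPolynomial σ k :=
      (b 0).constr (MvPolynomial σ k) fun j =>
        MvPolynomial.monomial (degExp (deg 0 j)) (aug (Finsupp.single j 1))
    have hE : IsScalarMatrix (b 0) (deg 0) (unitBasis k σ) 0 ε E := by
      refine ⟨fun j => mem_degLE.2 fun _ hj => ?_, fun j => ?_⟩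
      · obtain ⟨v, hv, -⟩ := haug j (by simpa [E] using hj)
        rw [← hv]
        exact monDeg_nonneg v
      · simp [ε, E, homogElem_unitBasis, Module.Basis.constr_basis]
    have hE0 : ∀ x, E x = 0 ↔ aug x = 0 := fun x => by simp [E]
    refine ⟨ε, hE.map_mem (hb 0) isHomogeneousBasis_unitBasis, le_antisymm ?_ ?_, ?_⟩
    · rw [LinearMap.range_eq_map, ← (b 0).span_eq, Submodule.map_span_le]
      rintro _ ⟨j, rfl⟩
      rw [Module.Basis.constr_basis]
      by_cases h0 : aug (Finsupp.single j 1) = 0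
      · rw [h0, map_zero]; exact zero_mem _
      · obtain ⟨v, hv, hvJ⟩ := haug j h0
        rw [← hv, degExp_monDeg]
        exact monomial_mem_of_ne_zero one_ne_zero hvJ _
    · refine hJ.trans (Ideal.span_le.2 ?_)
      rintro _ ⟨v, rfl, hv⟩
      obtain ⟨x, hx, hx0⟩ := (h.aug_iff (monDeg v)).1 ⟨v, rfl, hv⟩
      refine monomial_mem_of_ne_zero (J := LinearMap.range ε) hx0
        ⟨homogElem (b 0) (deg 0) (monDeg v) x, ?_⟩ 1
      rw [hE.apply_homogElem hx, homogElem_unitBasis, degExp_monDeg]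
      simp [E]
    · ext x
      rw [LinearMap.mem_ker, hE.apply_eq_zero_iff, (hL 0).mem_range_iff]
      refine forall_congr' fun a => ⟨fun h1 => ?_, ?_⟩
      · exact h.exact 0 a _ (homogCoord_mem _ _ _ _) ((hE0 _).1 h1)
      · rintro ⟨y, hy, hyx⟩
        rw [← hyx]
        exact (hE0 _).2 (h.mem_cycles 0 y)

end Resolution

/-! ### Minimal multigraded free resolutions and betti numbers -/

section ScalarComplex

variable {k : Type u} [Field k] {σ : Type} [Finite σ] {ι : ℕ → Type u}

/-- The multigraded map of free modules with a given matrix of scalars. -/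
noncomputable def homogenizedMap {κ l : Type u} (deg : κ → σ → ℤ) (deg' : l → σ → ℤ)
    (L : (κ →₀ k) →ₗ[k] (l →₀ k)) :
    (κ →₀ MvPolynomial σ k) →ₗ[MvPolynomial σ k] (l →₀ MvPolynomial σ k) :=
  Finsupp.linearCombination (MvPolynomial σ k) fun j =>
    homogElem Finsupp.basisSingleOne deg' (deg j) (L (Finsupp.single j 1))

theorem isScalarMatrix_homogenizedMap {κ l : Type u} {deg : κ → σ → ℤ} {deg' : l → σ → ℤ}
    {L : (κ →₀ k) →ₗ[k] (l →₀ k)} (hL : IsFiltered deg deg' L) :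
    IsScalarMatrix Finsupp.basisSingleOne deg Finsupp.basisSingleOne deg'
      (homogenizedMap deg deg' L) L :=
  ⟨hL, fun j => by simp [homogenizedMap]⟩

/-- The multigraded complex of free modules with given matrices of scalars. -/
noncomputable def scalarComplex (deg : ∀ i, ι i → σ → ℤ)
    (L : ∀ i, (ι (i + 1) →₀ k) →ₗ[k] (ι i →₀ k))
    (hL : ∀ i, IsFiltered (deg (i + 1)) (deg i) (L i)) (hLL : ∀ i, L i ∘ₗ L (i + 1) = 0) :
    GradedComplex (MvPolynomial σ k) (σ → ℤ) where
  X i := ι i →₀ MvPolynomial σ k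
  gr i a := (degLE k (deg i) a).toAddSubgroup.map
    (homogElem Finsupp.basisSingleOne (deg i) a)
  d i := homogenizedMap (deg (i + 1)) (deg i) (L i)
  d_comp_d i := ((isScalarMatrix_homogenizedMap (hL i)).comp
    (isScalarMatrix_homogenizedMap (hL (i + 1)))).eq_zero_iff.2 (hLL i)
  d_mem i a x hx := by
    obtain ⟨c, hc, rfl⟩ := hx
    exact ⟨L i c, (hL i).map_mem hc,
      ((isScalarMatrix_homogenizedMap (hL i)).apply_homogElem hc).symm⟩

end ScalarComplex

/-! ### Minimality in terms of scalar matrices -/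

section Minimal

variable {k : Type u} [Field k] {σ : Type}

theorem monomial_mem_span_X_iff (v : σ →₀ ℕ) (c : k) :
    MvPolynomial.monomial v c ∈ Ideal.span (Set.range (MvPolynomial.X : σ → MvPolynomial σ k)) ↔
      (c ≠ 0 → v ≠ 0) := by
  classical
  rw [← Set.image_univ, MvPolynomial.mem_ideal_span_X_image, MvPolynomial.support_monomial]
  by_cases hc : c = 0
  · simp [hc]
  · rw [if_neg hc]
    simp only [Finset.mem_singleton, forall_eq, Set.mem_univ, true_and, ne_eq, hc,
      not_false_eq_true, true_imp_iff]
    exact (Finsupp.ne_iff (f := v) (g := 0)).symm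

variable [Finite σ] {F : GradedComplex (MvPolynomial σ k) (σ → ℤ)} {J : Ideal (MvPolynomial σ k)}
  {ι : ℕ → Type u} {b : ∀ i, Module.Basis (ι i) (MvPolynomial σ k) (F.X i)}
  {deg : ∀ i, ι i → σ → ℤ} {L : ∀ i, (ι (i + 1) →₀ k) →ₗ[k] (ι i →₀ k)}

/-- A nonzero entry of the differential is a scalar times the monomial of degree `deg j - deg l`; it
lies in the ideal of the variables unless the two degrees agree. -/
theorem isMinimalComplex_iff
    (hL : ∀ i, IsScalarMatrix (b (i + 1)) (deg (i + 1)) (b i) (deg i) (F.d i) (L i)) :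
    IsMinimalComplex F ↔ IsStrict deg L := by
  refine forall_congr' fun i => ⟨fun h j l hl => ?_, fun h => ?_⟩
  · have h1 := h ⟨b (i + 1) j, rfl⟩
    have h2 : ∀ x ∈ Ideal.span (Set.range (MvPolynomial.X : σ → MvPolynomial σ k)) •
        (⊤ : Submodule (MvPolynomial σ k) (F.X i)), (b i).repr x l ∈
        Ideal.span (Set.range (MvPolynomial.X : σ → MvPolynomial σ k)) := by
      intro x hx
      induction hx using Submodule.smul_induction_on' with
      | smul r hr y _ =>
        rw [map_smul, Finsupp.smul_apply, smul_eq_mul]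
        exact Ideal.mul_mem_right _ _ hr
      | add x _ y _ hx hy =>
        rw [map_add, Finsupp.add_apply]
        exact add_mem hx hy
    have h3 := h2 _ h1
    rw [(hL i).apply_basis, repr_homogElem, monomial_mem_span_X_iff, hl, sub_self] at h3
    by_contra h0
    exact h3 h0 (by ext; simp [degExp])
  · rw [LinearMap.range_eq_map, ← (b (i + 1)).span_eq, Submodule.map_span_le]
    rintro _ ⟨j, rfl⟩
    rw [(hL i).apply_basis, ← Finsupp.sum_single (L i (Finsupp.single j 1)), Finsupp.sum, map_sum]
    refine sum_mem fun l hl => ?_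
    rw [homogElem_single]
    refine Submodule.smul_mem_smul ((monomial_mem_span_X_iff _ _).2 fun h0 h1 => h0 ?_) trivial
    have h2 := mem_degLE.1 ((hL i).filtered j) l h0
    have h3 := monDeg_degExp (sub_nonneg.2 h2)
    rw [h1] at h3
    refine h j l (sub_eq_zero.1 ?_).symm
    rw [← h3]
    ext
    simp [monDeg]

/-- Makes the sets whose infima define the betti numbers nonempty. -/
theorem IsFilteredResolution.exists_minimalComplex {aug : (ι 0 →₀ k) →ₗ[k] k}
    (h : IsFilteredResolution deg L aug (monomialDegrees J)) (hs : IsStrict deg L)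
    (hJ : J ≤ Ideal.span {p | ∃ v, p = MvPolynomial.monomial v (1 : k) ∧ p ∈ J}) :
    ∃ F : GradedComplex (MvPolynomial σ k) (σ → ℤ),
      IsMultigradedFreeResolution F J ∧ IsMinimalComplex F ∧
      ∀ i, ∃ b : Module.Basis (ι i) (MvPolynomial σ k) (F.X i),
        IsHomogeneousBasis (F.gr i) b (deg i) := by
  have hLL : ∀ i, L i ∘ₗ L (i + 1) = 0 := fun i => LinearMap.ext (h.mem_cycles (i + 1))
  have hb : ∀ i, IsHomogeneousBasis ((scalarComplex deg L h.filtered hLL).gr i)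
      Finsupp.basisSingleOne (deg i) := fun i a => (closure_smul_basis_eq _ _ _).symm
  have hL : ∀ i, IsScalarMatrix Finsupp.basisSingleOne (deg (i + 1)) Finsupp.basisSingleOne
      (deg i) ((scalarComplex deg L h.filtered hLL).d i) (L i) :=
    fun i => isScalarMatrix_homogenizedMap (h.filtered i)
  exact ⟨scalarComplex deg L h.filtered hLL, h.isMultigradedFreeResolution
    (b := fun _ => Finsupp.basisSingleOne) hb hL hJ,
    (isMinimalComplex_iff (b := fun _ => Finsupp.basisSingleOne) hL).2 hs, fun i => ⟨_, hb i⟩⟩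

end Minimal

theorem nonempty_embedding_of_fibers {ι κ P : Type*} {deg : ι → P} {deg' : κ → P}
    (h : ∀ a, Nonempty ({j // deg j = a} ↪ {j // deg' j = a})) : Nonempty (ι ↪ κ) :=
  ⟨(Equiv.sigmaFiberEquiv deg).symm.toEmbedding.trans
    ((Function.Embedding.sigmaMap (Function.Embedding.refl P) fun a => (h a).some).trans
      (Equiv.sigmaFiberEquiv deg').toEmbedding)⟩

theorem natCard_eq_of_embeddings {α β : Type*} (h : Nonempty (α ↪ β)) (h' : Nonempty (β ↪ α)) :
    Nat.card α = Nat.card β := by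
  obtain ⟨f⟩ := h
  obtain ⟨g⟩ := h'
  obtain ⟨e⟩ := Function.Embedding.antisymm f g
  exact Nat.card_congr e

/-! ### Uniqueness of the number of minimal generators -/

section Betti

variable {k : Type u} [Field k] {σ : Type} [Finite σ]

/-- Homogeneous bases, together with their index sets and degrees. -/
structure BundledHomogeneousBasis (k : Type u) [Field k] {σ : Type} {M : Type u} [AddCommGroup M] [Module (MvPolynomial σ k) M]
    (gr : (σ → ℤ) → AddSubgroup M) where
  ι : Type u
  basis : Module.Basis ι (MvPolynomial σ k) M
  deg : ι → σ → ℤ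
  isHomogeneous : IsHomogeneousBasis gr basis deg

variable {J : Ideal (MvPolynomial σ k)} {ι : ℕ → Type u}
  {deg : ∀ i, ι i → σ → ℤ} {L : ∀ i, (ι (i + 1) →₀ k) →ₗ[k] (ι i →₀ k)}
  {aug : (ι 0 →₀ k) →ₗ[k] k}

theorem IsFilteredResolution.fiber_embeddings
    (h : IsFilteredResolution deg L aug (monomialDegrees J)) (hs : IsStrict deg L)
    {F : GradedComplex (MvPolynomial σ k) (σ → ℤ)} (hF : IsMultigradedFreeResolution F J)
    (hmin : IsMinimalComplex F) (i : ℕ) (B : BundledHomogeneousBasis k (F.gr i)) (a : σ → ℤ) :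
    Nonempty ({j // deg i j = a} ↪ {j // B.deg j = a}) ∧
      Nonempty ({j // B.deg j = a} ↪ {j // deg i j = a}) := by
  classical
  have hB : ∀ i, Nonempty (BundledHomogeneousBasis k (F.gr i)) := fun i => by
    obtain ⟨ι, b, deg, hb⟩ := hF.1 i
    exact ⟨⟨ι, b, deg, hb⟩⟩
  -- The comparison needs bases in all homological degrees; the prescribed `B` is used in degree `i`
  -- and arbitrary ones elsewhere.
  let T : ∀ i, BundledHomogeneousBasis k (F.gr i) :=
    Function.update (fun i => (hB i).some) i B
  have hT : T i = B := Function.update_self _ _ _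
  obtain ⟨L', aug', hL', h'⟩ := hF.exists_filteredResolution fun i => (T i).isHomogeneous
  have hs' := (isMinimalComplex_iff (b := fun i => (T i).basis)
    (deg := fun i => (T i).deg) hL').1 hmin
  have h1 := h.fiber_embedding hs h' i a
  have h2 := h'.fiber_embedding hs' h i a
  rw [hT] at h1 h2
  exact ⟨h1, h2⟩

/-- The infimum is attained by some minimal resolution, and generators of two minimal resolutions
embed into each other degree by degree. -/
theorem IsFilteredResolution.multigradedBetti_eq
    (h : IsFilteredResolution deg L aug (monomialDegrees J)) (hs : IsStrict deg L)
    (hJ : J ≤ Ideal.span {p | ∃ v, p = MvPolynomial.monomial v (1 : k) ∧ p ∈ J})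
    (i : ℕ) (a : σ → ℤ) : multigradedBetti J i a = Nat.card {j // deg i j = a} := by
  obtain ⟨F₀, hF₀, hmin₀, hb₀⟩ := h.exists_minimalComplex hs hJ
  obtain ⟨b₀, hb₀⟩ := hb₀ i
  obtain ⟨F, hF, hmin, κ, b, degF, hb, hc⟩ := Nat.sInf_mem (s := {c |
    ∃ F : GradedComplex (MvPolynomial σ k) (σ → ℤ),
      IsMultigradedFreeResolution F J ∧ IsMinimalComplex F ∧
      ∃ (ι : Type u) (b : Module.Basis ι (MvPolynomial σ k) (F.X i)) (deg : ι → σ → ℤ),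
        IsHomogeneousBasis (F.gr i) b deg ∧ c = Nat.card {j : ι // deg j = a}})
    ⟨_, F₀, hF₀, hmin₀, ι i, b₀, deg i, hb₀, rfl⟩
  refine Eq.trans hc ?_
  obtain ⟨h1, h2⟩ := h.fiber_embeddings hs hF hmin i ⟨κ, b, degF, hb⟩ a
  exact natCard_eq_of_embeddings h2 h1

theorem IsFilteredResolution.totalBetti_eq
    (h : IsFilteredResolution deg L aug (monomialDegrees J)) (hs : IsStrict deg L)
    (hJ : J ≤ Ideal.span {p | ∃ v, p = MvPolynomial.monomial v (1 : k) ∧ p ∈ J})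
    (i : ℕ) : totalBetti J i = Nat.card (ι i) := by
  obtain ⟨F₀, hF₀, hmin₀, -⟩ := h.exists_minimalComplex hs hJ
  obtain ⟨F, hF, hmin, hc⟩ := Nat.sInf_mem (s := {c |
    ∃ F : GradedComplex (MvPolynomial σ k) (σ → ℤ),
      IsMultigradedFreeResolution F J ∧ IsMinimalComplex F ∧
      c = Module.finrank (MvPolynomial σ k) (F.X i)})
    ⟨_, F₀, hF₀, hmin₀, rfl⟩
  refine Eq.trans hc ?_
  obtain ⟨κ, b, degF, hb⟩ := hF.1 i
  rw [Module.finrank_eq_nat_card_basis b]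
  have h1 := h.fiber_embeddings hs hF hmin i ⟨κ, b, degF, hb⟩
  exact natCard_eq_of_embeddings (nonempty_embedding_of_fibers fun a => (h1 a).2)
    (nonempty_embedding_of_fibers fun a => (h1 a).1)

end Betti

/-! ### Powers of monomial ideals -/

section Powers

variable {k : Type u} [Field k] {σ : Type} {q : ℕ} (m : Fin q → σ →₀ ℕ) (r : ℕ)

/-- In the semiring of ideals, adding the unit ideal gives the unit ideal. Multinomial coefficients
therefore disappear. -/
theorem Ideal.natCast_eq_one {R : Type*} [CommSemiring R] {n : ℕ} (hn : n ≠ 0) :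
    (n : Ideal R) = 1 := by
  obtain ⟨n, rfl⟩ := Nat.exists_eq_succ_of_ne_zero hn
  rw [Nat.cast_succ, Submodule.add_eq_sup, Ideal.one_eq_top, sup_top_eq]

/-- The multinomial theorem in the semiring of ideals, applied to the sum of the principal ideals of
the generators. -/
theorem monomialIdeal_pow : monomialIdeal k m ^ r =
    Ideal.span ((fun v => MvPolynomial.monomial v (1 : k)) ''
      Set.range (powerLabel (r := r) m)) := by
  classical
  have h1 : monomialIdeal k m =
      ∑ j, Ideal.span {MvPolynomial.monomial (m j) (1 : k)} := by
    rw [monomialIdeal, ← Set.iUnion_singleton_eq_range, Ideal.span_iUnion,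
      Ideal.sum_eq_sup, Finset.sup_univ_eq_iSup]
  have h2 : ∀ a : Fin q → ℕ, ∏ j, Ideal.span {MvPolynomial.monomial (m j) (1 : k)} ^ a j =
      Ideal.span {MvPolynomial.monomial (∑ j, a j • m j) (1 : k)} := by
    intro a
    simp only [Ideal.span_singleton_pow, Ideal.prod_span_singleton, MvPolynomial.monomial_pow,
      one_pow, MvPolynomial.monomial_sum_one]
  rw [h1, Finset.sum_pow_eq_sum_piAntidiag]
  simp only [h2, Ideal.natCast_eq_one (Nat.multinomial_pos _ _).ne', one_mul]
  rw [Ideal.sum_eq_sup]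
  apply le_antisymm
  · refine Finset.sup_le fun a ha => Ideal.span_mono ?_
    rw [Set.singleton_subset_iff]
    exact ⟨_, ⟨⟨toLex a, Finset.mem_map_of_mem _ ha⟩, rfl⟩, rfl⟩
  · rw [Ideal.span_le]
    rintro _ ⟨_, ⟨⟨a', ha'⟩, rfl⟩, rfl⟩
    obtain ⟨a, ha, rfl⟩ := Finset.mem_map.1 ha'
    exact (Finset.le_sup (f := fun a : Fin q → ℕ =>
      Ideal.span {MvPolynomial.monomial (∑ j, a j • m j) (1 : k)}) ha)
      (Ideal.subset_span rfl)

theorem monomial_mem_monomialIdeal_pow (v : σ →₀ ℕ) :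
    MvPolynomial.monomial v 1 ∈ monomialIdeal k m ^ r ↔
      ∃ a : PowerIndex q r, powerLabel m a ≤ v := by
  classical
  rw [monomialIdeal_pow, MvPolynomial.mem_ideal_span_monomial_image,
    MvPolynomial.support_monomial]
  simp

theorem monomialIdeal_pow_le : monomialIdeal k m ^ r ≤
    Ideal.span {p | ∃ v, p = MvPolynomial.monomial v (1 : k) ∧ p ∈ monomialIdeal k m ^ r} := by
  conv_lhs => rw [monomialIdeal_pow]
  refine Ideal.span_mono ?_
  rintro _ ⟨_, ⟨a, rfl⟩, rfl⟩
  exact ⟨_, rfl, (monomial_mem_monomialIdeal_pow m r _).2 ⟨a, le_rfl⟩⟩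

variable [Finite σ]

theorem monomialDegrees_monomialIdeal_pow : monomialDegrees (monomialIdeal k m ^ r) =
    {d | ∃ a : PowerIndex q r, monDeg (powerLabel m a) ≤ d} := by
  ext d
  constructor
  · rintro ⟨v, rfl, hv⟩
    obtain ⟨a, ha⟩ := (monomial_mem_monomialIdeal_pow m r v).1 hv
    exact ⟨a, monDeg_le_monDeg.2 ha⟩
  · rintro ⟨a, ha⟩
    have h0 : 0 ≤ d := (monDeg_nonneg _).trans ha
    refine ⟨degExp d, monDeg_degExp h0, (monomial_mem_monomialIdeal_pow m r _).2 ⟨a, ?_⟩⟩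
    rwa [← monDeg_le_monDeg, monDeg_degExp h0]

/-- Powers of monomial ideals have minimal resolutions whose degrees are least common multiples of
the generators. -/
theorem exists_minimal_resolution_monomialIdeal_pow :
    ∃ (ι : ℕ → Type u) (deg : ∀ i, ι i → σ → ℤ)
      (L : ∀ i, (ι (i + 1) →₀ k) →ₗ[k] (ι i →₀ k)) (aug : (ι 0 →₀ k) →ₗ[k] k),
      IsFilteredResolution deg L aug (monomialDegrees (monomialIdeal k m ^ r)) ∧
      IsStrict deg L ∧ (∀ i, Finite (ι i)) ∧
      ∀ i j, ∃ e ∈ powerLCMs m r, monDeg e = deg i j := by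
  classical
  obtain ⟨ι, deg, L, aug, h1, h2, h3, h4⟩ := exists_minimal_filteredResolution (k := k)
    (U := monomialDegrees (monomialIdeal k m ^ r)) (A := (powerLCMs m r).image monDeg) (by
      intro a ha b hb
      obtain ⟨e, he, rfl⟩ := Finset.mem_image.1 ha
      obtain ⟨e', he', rfl⟩ := Finset.mem_image.1 hb
      rw [← monDeg_sup]
      refine Finset.mem_image_of_mem _ ?_
      simp only [powerLCMs, Finset.mem_image, Finset.mem_filter, Finset.mem_univ, true_and] at *
      obtain ⟨T, hT, rfl⟩ := he
      obtain ⟨T', hT', rfl⟩ := he'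
      exact ⟨T ∪ T', hT.mono Finset.subset_union_left, Finset.sup_union⟩) (by
      rw [monomialDegrees_monomialIdeal_pow]
      rintro a b hab ⟨c, hc⟩
      exact ⟨c, hc.trans hab⟩) (by
      rw [monomialDegrees_monomialIdeal_pow]
      rintro a ⟨c, hc⟩
      refine ⟨_, Finset.mem_image_of_mem _ ?_, hc, c, le_rfl⟩
      simp only [powerLCMs, Finset.mem_image, Finset.mem_filter, Finset.mem_univ, true_and]
      exact ⟨{c}, Finset.singleton_nonempty c, Finset.sup_singleton ..⟩)
  exact ⟨ι, deg, L, aug, h1, h2, h3, fun i j => Finset.mem_image.1 (h4 i j)⟩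

end Powers

/-! ### Base change along monomial maps -/

section BaseChange

variable {k : Type u} [Field k] {τ σ : Type} [Finite τ]
  [Algebra (MvPolynomial τ k) (MvPolynomial σ k)] {φ : (τ → ℤ) → σ → ℤ}

/-- For homogeneous `s` and `p`, the tensor `s ⊗ (p • b j)` is the image of `p` times `s`, times `1
⊗ b j`, and the algebra map shifts degrees by `φ`. -/
theorem isHomogeneousBasis_baseChange (hadd : ∀ a b, φ (a + b) = φ a + φ b)
    (hmon : ∀ v c, ∃ w, monDeg w = φ (monDeg v) ∧
      algebraMap (MvPolynomial τ k) (MvPolynomial σ k) (MvPolynomial.monomial v c) =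
        MvPolynomial.monomial w c)
    {M : Type u} [AddCommGroup M] [Module (MvPolynomial τ k) M] {ι : Type u}
    {b : Module.Basis ι (MvPolynomial τ k) M} {deg : ι → τ → ℤ}
    {gr : (τ → ℤ) → AddSubgroup M} (hb : IsHomogeneousBasis gr b deg) :
    IsHomogeneousBasis (tensorGrading (MvPolynomial τ k) (MvPolynomial σ k) M (stdGrading k σ)
      (regrade φ gr)) (b.baseChange (MvPolynomial σ k)) (φ ∘ deg) := by
  have halg : ∀ a, ∀ p ∈ stdGrading k τ a,
      algebraMap (MvPolynomial τ k) (MvPolynomial σ k) p ∈ stdGrading k σ (φ a) := by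
    intro a p hp
    induction hp using AddSubgroup.closure_induction with
    | mem p hp =>
      obtain ⟨v, c, rfl, rfl⟩ := hp
      obtain ⟨w, hw, h⟩ := hmon v c
      rw [h]
      exact monomial_mem_stdGrading w c hw
    | zero => rw [map_zero]; exact zero_mem _
    | add p q _ _ hp hq => rw [map_add]; exact add_mem hp hq
    | neg p _ hp => rw [map_neg]; exact neg_mem hp
  intro m
  apply le_antisymm
  · refine (AddSubgroup.closure_le _).2 ?_
    rintro _ ⟨a, e, s, x, hs, hx, rfl, rfl⟩
    let f : M →+ MvPolynomial σ k ⊗[MvPolynomial τ k] M :=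
      (TensorProduct.mk (MvPolynomial τ k) (MvPolynomial σ k) M s).toAddMonoidHom
    have key : regrade φ gr e ≤ (AddSubgroup.closure {x | ∃ (j : ι) (a' : σ → ℤ),
        ∃ p ∈ stdGrading k σ a', a' + (φ ∘ deg) j = a + e ∧
          x = p • b.baseChange (MvPolynomial σ k) j}).comap f := by
      refine iSup₂_le fun d hd => ?_
      rw [hb d, AddSubgroup.closure_le]
      rintro _ ⟨j, a', p, hp, rfl, rfl⟩
      refine AddSubgroup.subset_closure ⟨j, a + φ a',
        s * algebraMap (MvPolynomial τ k) (MvPolynomial σ k) p,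
        mul_mem_stdGrading hs (halg a' p hp), ?_, ?_⟩
      · rw [← hd, hadd, add_assoc]; rfl
      · change s ⊗ₜ[MvPolynomial τ k] (p • b j) = _
        rw [Module.Basis.baseChange_apply, TensorProduct.smul_tmul', smul_eq_mul, mul_one,
          TensorProduct.tmul_smul, TensorProduct.smul_tmul', Algebra.smul_def, mul_comm]
    exact key hx
  · rw [AddSubgroup.closure_le]
    rintro _ ⟨j, a, p, hp, rfl, rfl⟩
    refine AddSubgroup.subset_closure ⟨a, φ (deg j), p, b j, hp, ?_, rfl, ?_⟩
    · refine (le_iSup₂ (f := fun d (_ : φ d = φ (deg j)) => gr d) (deg j) rfl) ?_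
      exact hb.mem_iff.2 ⟨_, single_mem_degLE le_rfl 1, homogElem_deg_single b deg j⟩
    · rw [Module.Basis.baseChange_apply, TensorProduct.smul_tmul', smul_eq_mul, mul_one]

variable [Finite σ]

theorem tmul_homogElem (hadd : ∀ a b, φ (a + b) = φ a + φ b)
    (hmon : ∀ v c, ∃ w, monDeg w = φ (monDeg v) ∧
      algebraMap (MvPolynomial τ k) (MvPolynomial σ k) (MvPolynomial.monomial v c) =
        MvPolynomial.monomial w c)
    {M : Type*} [AddCommGroup M] [Module (MvPolynomial τ k) M] {ι : Type*}
    (b : Module.Basis ι (MvPolynomial τ k) M) (deg : ι → τ → ℤ) {a : τ → ℤ} {c : ι →₀ k}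
    (hc : c ∈ degLE k deg a) :
    (1 : MvPolynomial σ k) ⊗ₜ[MvPolynomial τ k] homogElem b deg a c =
      homogElem (b.baseChange (MvPolynomial σ k)) (φ ∘ deg) (φ a) c := by
  rw [← Finsupp.sum_single c, Finsupp.sum, map_sum, map_sum, TensorProduct.tmul_sum]
  refine Finset.sum_congr rfl fun j hj => ?_
  rw [homogElem_single, homogElem_single, TensorProduct.tmul_smul, TensorProduct.smul_tmul',
    Algebra.smul_def, mul_one, Module.Basis.baseChange_apply, TensorProduct.smul_tmul',
    smul_eq_mul, mul_one]
  obtain ⟨w, hw, h⟩ := hmon (degExp (a - deg j)) (c j)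
  rw [monDeg_degExp (sub_nonneg.2 (mem_degLE.1 hc j (Finsupp.mem_support_iff.1 hj)))] at hw
  have h1 : φ (a - deg j) = φ a - φ (deg j) := by
    rw [eq_sub_iff_add_eq, ← hadd, sub_add_cancel]
  rw [h, ← degExp_monDeg w, hw, h1]
  rfl

/-- Monomials go to monomials with the same coefficient, so the matrix of scalars is unchanged; only
the degrees move. -/
theorem IsScalarMatrix.baseChange (hadd : ∀ a b, φ (a + b) = φ a + φ b)
    (hsup : ∀ a b, φ (a ⊔ b) = φ a ⊔ φ b)
    (hmon : ∀ v c, ∃ w, monDeg w = φ (monDeg v) ∧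
      algebraMap (MvPolynomial τ k) (MvPolynomial σ k) (MvPolynomial.monomial v c) =
        MvPolynomial.monomial w c)
    {M N : Type*} [AddCommGroup M] [Module (MvPolynomial τ k) M]
    [AddCommGroup N] [Module (MvPolynomial τ k) N] {ι κ : Type*}
    {b : Module.Basis ι (MvPolynomial τ k) M} {deg : ι → τ → ℤ}
    {b' : Module.Basis κ (MvPolynomial τ k) N} {deg' : κ → τ → ℤ}
    {f : M →ₗ[MvPolynomial τ k] N} {L : (ι →₀ k) →ₗ[k] (κ →₀ k)}
    (h : IsScalarMatrix b deg b' deg' f L) :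
    IsScalarMatrix (b.baseChange (MvPolynomial σ k)) (φ ∘ deg)
      (b'.baseChange (MvPolynomial σ k)) (φ ∘ deg') (f.baseChange (MvPolynomial σ k)) L :=
  ⟨fun j => degLE_comp_le hsup le_rfl (h.filtered j), fun j => by
    rw [Module.Basis.baseChange_apply, LinearMap.baseChange_tmul, h.apply_basis,
      tmul_homogElem hadd hmon b' deg' (h.filtered j)]
    rfl⟩

end BaseChange

/-! ### The homogenized chain complex -/

section Homogenization

variable {k : Type u} [Field k] {σ : Type} {V : Type}
  (Δ : PreAbstractSimplicialComplex V) (label : V → σ →₀ ℕ)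

/-- The basis of faces. -/
noncomputable def faceBasis (k : Type u) [Field k] (σ : Type) (i : ℕ) :
    Module.Basis (ULift.{u} (FaceOfDim Δ i)) (MvPolynomial σ k)
      (FaceOfDim Δ i →₀ MvPolynomial σ k) :=
  Finsupp.basisSingleOne.reindex Equiv.ulift.symm

theorem faceBasis_apply (i : ℕ) (s : ULift.{u} (FaceOfDim Δ i)) :
    faceBasis Δ k σ i s = Finsupp.single s.down 1 := by
  simp [faceBasis]

/-- The multidegrees of the faces. -/
noncomputable def faceDeg (i : ℕ) (s : ULift.{u} (FaceOfDim Δ i)) : σ → ℤ :=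
  monDeg (faceLabel label s.down.1)

variable [LinearOrder V]

/-- The boundary map of the simplicial chain complex. -/
noncomputable def scalarBoundary (k : Type u) [Field k] (i : ℕ) :
    (ULift.{u} (FaceOfDim Δ (i + 1)) →₀ k) →ₗ[k] (ULift.{u} (FaceOfDim Δ i) →₀ k) :=
  Finsupp.linearCombination k fun s =>
    ∑ v : s.down.1, Finsupp.single (ULift.up (s.down.erase v)) ((faceSign s.down.1 v : ℤ) : k)

theorem isHomogeneousBasis_faceBasis (i : ℕ) :
    IsHomogeneousBasis ((homogenization k Δ label).gr i) (faceBasis Δ k σ i)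
      (faceDeg Δ label i) := by
  intro a
  apply le_antisymm
  · refine (AddSubgroup.closure_le _).2 ?_
    rintro _ ⟨s, v, c, rfl, rfl⟩
    refine AddSubgroup.subset_closure ⟨ULift.up s, monDeg v, MvPolynomial.monomial v c,
      monomial_mem_stdGrading v c rfl, rfl, ?_⟩
    rw [faceBasis_apply, Finsupp.smul_single, smul_eq_mul, mul_one]
  · rw [AddSubgroup.closure_le]
    rintro _ ⟨s, a', p, hp, rfl, rfl⟩
    induction hp using AddSubgroup.closure_induction with
    | mem p hp =>
      obtain ⟨v, c, rfl, rfl⟩ := hp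
      refine AddSubgroup.subset_closure ⟨s.down, v, c, rfl, ?_⟩
      rw [faceBasis_apply, Finsupp.smul_single, smul_eq_mul, mul_one]
    | zero => rw [zero_smul]; exact zero_mem _
    | add p q _ _ hp hq => rw [add_smul]; exact add_mem hp hq
    | neg p _ hp => rw [neg_smul]; exact neg_mem hp

variable [Finite σ]

theorem degExp_monDeg_sub (v w : σ →₀ ℕ) : degExp (monDeg v - monDeg w) = v - w := by
  ext s
  simp [degExp, monDeg]

/-- The labels enter the differential only through exponents, so the scalars are the signs of the
simplicial boundary, whatever the labeling. -/
theorem isScalarMatrix_homogenization (i : ℕ) :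
    IsScalarMatrix (faceBasis Δ k σ (i + 1)) (faceDeg Δ label (i + 1)) (faceBasis Δ k σ i)
      (faceDeg Δ label i) ((homogenization k Δ label).d i) (scalarBoundary Δ k i) := by
  refine ⟨fun s => ?_, fun s => ?_⟩
  · simp only [scalarBoundary, Finsupp.linearCombination_single, one_smul]
    refine sum_mem fun v _ => single_mem_degLE ?_ _
    have : faceLabel label (s.down.1.erase v) ≤ faceLabel label s.down.1 :=
      Finset.sup_mono (Finset.erase_subset _ _)
    exact monDeg_le_monDeg.2 this
  · rw [faceBasis_apply, Finsupp.linearCombination_single, one_smul, faceBoundary, scalarBoundary,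
      Finsupp.linearCombination_single, one_smul, map_sum]
    refine Finset.sum_congr rfl fun v _ => ?_
    rw [homogElem_single, faceBasis_apply, Finsupp.smul_single, smul_eq_mul, mul_one, faceDeg,
      faceDeg, degExp_monDeg_sub]
    rfl

end Homogenization

theorem IsScalarMatrix.unique {k : Type u} [Field k] {σ : Type} [Finite σ] {M N : Type*}
    [AddCommGroup M] [Module (MvPolynomial σ k) M] [AddCommGroup N] [Module (MvPolynomial σ k) N]
    {ι κ : Type*} {b : Module.Basis ι (MvPolynomial σ k) M} {deg : ι → σ → ℤ}
    {b' : Module.Basis κ (MvPolynomial σ k) N} {deg' : κ → σ → ℤ}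
    {f : M →ₗ[MvPolynomial σ k] N} {L L' : (ι →₀ k) →ₗ[k] (κ →₀ k)}
    (h : IsScalarMatrix b deg b' deg' f L) (h' : IsScalarMatrix b deg b' deg' f L') : L = L' := by
  refine Finsupp.lhom_ext' fun j => LinearMap.ext_ring ?_
  have h1 := homogCoord_homogElem b' deg' (h.filtered j)
  rw [← h.apply_basis, h'.apply_basis, homogCoord_homogElem b' deg' (h'.filtered j)] at h1
  simpa using h1.symm

/-! ### The map from the extremal ideal -/

section Psi

variable {k : Type u} [Field k] {n q : ℕ} (m : Fin q → Fin n →₀ ℕ)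

/-- Each coordinate of `psiDeg` is a single coordinate of `e`, or `0` when `A_t` is empty. Hence it
commutes with sums and with joins. -/
theorem psiDeg_apply (e : ExtremalVar q → ℤ) (t : Fin n) (h : (dividedSet m t).Nonempty) :
    psiDeg m e t = e ⟨dividedSet m t, h⟩ := by
  rw [psiDeg, Finset.sum_eq_single ⟨dividedSet m t, h⟩]
  · simp
  · intro A _ hA
    rw [if_neg]
    intro h'
    exact hA (Subtype.ext h'.symm)
  · simp

theorem psiDeg_apply_of_not (e : ExtremalVar q → ℤ) (t : Fin n)
    (h : ¬ (dividedSet m t).Nonempty) : psiDeg m e t = 0 := by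
  refine Finset.sum_eq_zero fun A _ => if_neg ?_
  intro h'
  exact h (h' ▸ A.2)

theorem psiDeg_add (a b : ExtremalVar q → ℤ) : psiDeg m (a + b) = psiDeg m a + psiDeg m b := by
  ext t
  by_cases h : (dividedSet m t).Nonempty
  · simp [psiDeg_apply m _ t h]
  · simp [psiDeg_apply_of_not m _ t h]

theorem psiDeg_sup (a b : ExtremalVar q → ℤ) : psiDeg m (a ⊔ b) = psiDeg m a ⊔ psiDeg m b := by
  ext t
  by_cases h : (dividedSet m t).Nonempty
  · simp [psiDeg_apply m _ t h]
  · simp [psiDeg_apply_of_not m _ t h]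

theorem psiDeg_mono {a b : ExtremalVar q → ℤ} (h : a ≤ b) : psiDeg m a ≤ psiDeg m b := by
  rw [← sup_eq_right, ← psiDeg_sup, sup_eq_right.2 h]

theorem psi_monomial (v : ExtremalVar q →₀ ℕ) (c : k) :
    ∃ w, monDeg w = psiDeg m (monDeg v) ∧
      psi k m (MvPolynomial.monomial v c) = MvPolynomial.monomial w c := by
  refine ⟨∑ A, v A • ∑ t with dividedSet m t = A.1, Finsupp.single t 1, ?_, ?_⟩
  · ext t
    simp only [monDeg, psiDeg, Finsupp.finsetSum_apply, Finsupp.smul_apply, smul_eq_mul]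
    rw [Nat.cast_sum]
    refine Finset.sum_congr rfl fun A _ => ?_
    have : ∀ x : Fin n, (Finsupp.single x 1 : Fin n →₀ ℕ) t = if x = t then 1 else 0 :=
      fun x => Finsupp.single_apply
    simp only [this, Finset.sum_ite_eq', Finset.mem_filter, Finset.mem_univ, true_and]
    split_ifs <;> simp
  · rw [psi, MvPolynomial.aeval_monomial, Finsupp.prod_fintype _ _ fun _ => pow_zero _,
      MvPolynomial.algebraMap_eq]
    have h1 : ∀ A : ExtremalVar q,
        (∏ t with dividedSet m t = A.1, (MvPolynomial.X t : MvPolynomial (Fin n) k)) ^ v A =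
        MvPolynomial.monomial (v A • ∑ t with dividedSet m t = A.1, Finsupp.single t 1) 1 := by
      intro A
      have h2 : ∏ t with dividedSet m t = A.1, (MvPolynomial.X t : MvPolynomial (Fin n) k) =
          MvPolynomial.monomial (∑ t with dividedSet m t = A.1, Finsupp.single t 1) 1 := by
        rw [MvPolynomial.monomial_sum_one]
        rfl
      rw [h2, MvPolynomial.monomial_pow, one_pow]
    simp only [h1]
    rw [← MvPolynomial.monomial_sum_one, MvPolynomial.C_mul_monomial, mul_one]

theorem psi_monomial_eq_iff (v : ExtremalVar q →₀ ℕ) (w : Fin n →₀ ℕ) :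
    psi k m (MvPolynomial.monomial v 1) = MvPolynomial.monomial w 1 ↔
      psiDeg m (monDeg v) = monDeg w := by
  obtain ⟨w', h1, h2⟩ := psi_monomial (k := k) m v 1
  rw [h2, ← h1, monDeg_injective.eq_iff, MvPolynomial.monomial_left_inj one_ne_zero]

theorem mem_lcmFiber {r : ℕ} {μ : Fin n →₀ ℕ} {e : ExtremalVar q →₀ ℕ} :
    e ∈ lcmFiber k m r μ ↔ e ∈ powerLCMs (extremalGen q) r ∧
      psiDeg m (monDeg e) = monDeg μ := by
  rw [← psi_monomial_eq_iff (k := k)]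
  simp only [lcmFiber, Finset.mem_filter]

theorem extremalGen_apply (i : Fin q) (A : ExtremalVar q) :
    extremalGen q i A = if i ∈ A.1 then 1 else 0 := by
  have : ∀ x : ExtremalVar q, (Finsupp.single x 1 : ExtremalVar q →₀ ℕ) A =
      if x = A then 1 else 0 := fun x => Finsupp.single_apply
  simp [extremalGen, Finsupp.finsetSum_apply, this]

variable {m}

/-- Here square-freeness enters: the exponent of `x_t` in `m_j` is `1` iff `j ∈ A_t`, which is the
exponent of `x_{A_t}` in `ε_j`. -/
theorem psiDeg_powerLabel (hsqfree : ∀ j t, m j t ≤ 1) {r : ℕ} (a : PowerIndex q r) :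
    psiDeg m (monDeg (powerLabel (extremalGen q) a)) = monDeg (powerLabel m a) := by
  ext t
  have hm : ∀ j, m j t = if j ∈ dividedSet m t then 1 else 0 := by
    intro j
    have := hsqfree j t
    simp only [dividedSet, Finset.mem_filter, Finset.mem_univ, true_and]
    split_ifs <;> omega
  by_cases h : (dividedSet m t).Nonempty
  · simp [psiDeg_apply m _ t h, monDeg, powerLabel, Finsupp.finsetSum_apply, extremalGen_apply, hm]
  · rw [psiDeg_apply_of_not m _ t h]
    rw [Finset.not_nonempty_iff_eq_empty] at h
    simp [monDeg, powerLabel, Finsupp.finsetSum_apply, hm, h]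

theorem psiDeg_faceLabel (hsqfree : ∀ j t, m j t ≤ 1) {r : ℕ} (s : Finset (PowerIndex q r)) :
    psiDeg m (monDeg (faceLabel (powerLabel (extremalGen q)) s)) =
      monDeg (faceLabel (powerLabel m) s) := by
  classical
  induction s using Finset.induction with
  | empty =>
    ext t
    by_cases h : (dividedSet m t).Nonempty
    · simp [faceLabel, monDeg, psiDeg_apply m _ t h]
    · simp [faceLabel, monDeg, psiDeg_apply_of_not m _ t h]
  | insert a s _ ih =>
    simp only [faceLabel, Finset.sup_insert] at ih ⊢
    rw [monDeg_sup, monDeg_sup, psiDeg_sup, ih, psiDeg_powerLabel hsqfree]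

theorem IsFilteredResolution.map_psiDeg (hsqfree : ∀ j t, m j t ≤ 1) {r : ℕ} {ι : ℕ → Type*}
    {deg : ∀ i, ι i → ExtremalVar q → ℤ} {L : ∀ i, (ι (i + 1) →₀ k) →ₗ[k] (ι i →₀ k)}
    {aug : (ι 0 →₀ k) →ₗ[k] k}
    (h : IsFilteredResolution deg L aug (monomialDegrees (extremalIdeal k q ^ r))) :
    IsFilteredResolution (fun i => psiDeg m ∘ deg i) L aug
      (monomialDegrees (monomialIdeal k m ^ r)) := by
  have h1 := h.map (psiDeg_sup m)
  -- Both sides are the upper set generated by the degrees of the `m^a`.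
  have h2 : {a' | ∃ a ∈ monomialDegrees (extremalIdeal k q ^ r), psiDeg m a ≤ a'} =
      monomialDegrees (monomialIdeal k m ^ r) := by
    rw [extremalIdeal, monomialDegrees_monomialIdeal_pow, monomialDegrees_monomialIdeal_pow]
    ext d
    constructor
    · rintro ⟨a, ⟨c, hc⟩, ha⟩
      exact ⟨c, psiDeg_powerLabel hsqfree c ▸ (psiDeg_mono m hc).trans ha⟩
    · rintro ⟨c, hc⟩
      exact ⟨_, ⟨c, le_rfl⟩, (psiDeg_powerLabel hsqfree c).le.trans hc⟩
  rwa [h2] at h1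

theorem psiBaseChange_isMultigradedFreeResolution (hsqfree : ∀ j t, m j t ≤ 1) {r : ℕ}
    {F : GradedComplex (MvPolynomial (ExtremalVar q) k) (ExtremalVar q → ℤ)}
    (hF : IsMultigradedFreeResolution F (extremalIdeal k q ^ r)) :
    IsMultigradedFreeResolution (psiBaseChange m F) (monomialIdeal k m ^ r) := by
  choose ι b deg hb using hF.1
  obtain ⟨L, aug, hL, h⟩ := hF.exists_filteredResolution hb
  let : Algebra (MvPolynomial (ExtremalVar q) k) (MvPolynomial (Fin n) k) :=
    (psi k m).toRingHom.toAlgebra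
  exact (h.map_psiDeg hsqfree).isMultigradedFreeResolution (F := psiBaseChange m F)
    (b := fun i => (b i).baseChange (MvPolynomial (Fin n) k))
    (fun i => isHomogeneousBasis_baseChange (psiDeg_add m) (psi_monomial m) (hb i))
    (fun i => (hL i).baseChange (psiDeg_add m) (psiDeg_sup m) (psi_monomial m))
    (monomialIdeal_pow_le m r)

theorem SupportsResolution.relabel (hsqfree : ∀ j t, m j t ≤ 1) {r : ℕ}
    {Δ : PreAbstractSimplicialComplex (PowerIndex q r)}
    (hΔ : SupportsResolution k Δ (powerLabel (extremalGen q)) (extremalIdeal k q ^ r)) :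
    SupportsResolution k Δ (powerLabel m) (monomialIdeal k m ^ r) := by
  obtain ⟨L, aug, hL, h⟩ := IsMultigradedFreeResolution.exists_filteredResolution hΔ
    (isHomogeneousBasis_faceBasis Δ _)
  -- Scalar matrices are unique, so the one obtained from the labeling by `ε^a` is the boundary that
  -- does not depend on labels.
  obtain rfl : L = scalarBoundary Δ k :=
    funext fun i => (hL i).unique (isScalarMatrix_homogenization Δ _ i)
  have h1 := h.map_psiDeg hsqfree
  have h2 : (fun i => psiDeg m ∘ faceDeg.{u} Δ (powerLabel (extremalGen q)) i) =
      faceDeg Δ (powerLabel m) :=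
    funext fun i => funext fun s => psiDeg_faceLabel hsqfree s.down.1
  rw [h2] at h1
  exact h1.isMultigradedFreeResolution (isHomogeneousBasis_faceBasis Δ _)
    (isScalarMatrix_homogenization Δ _) (monomialIdeal_pow_le m r)

theorem betti_le (hsqfree : ∀ j t, m j t ≤ 1) (r i : ℕ) :
    (∀ μ : Fin n →₀ ℕ, multigradedBetti (monomialIdeal k m ^ r) i (monDeg μ) ≤
      ∑ e ∈ lcmFiber k m r μ, multigradedBetti (extremalIdeal k q ^ r) i (monDeg e)) ∧
    totalBetti (monomialIdeal k m ^ r) i ≤ totalBetti (extremalIdeal k q ^ r) i := by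
  classical
  obtain ⟨ι, deg, L, aug, h, hs, hfin, hlcm⟩ :=
    exists_minimal_resolution_monomialIdeal_pow (k := k) (extremalGen q) r
  obtain ⟨κ, deg', L', aug', h', hs', -, -⟩ :=
    exists_minimal_resolution_monomialIdeal_pow (k := k) m r
  -- The minimal resolution of `I^r` is compared with the pushed-forward minimal resolution of
  -- `ℰ_q^r`, which need not be minimal.
  have hemb := h'.fiber_embedding hs' (h.map_psiDeg hsqfree) i
  have := hfin i
  constructor
  · intro μ
    rw [h'.multigradedBetti_eq hs' (monomialIdeal_pow_le m r)]
    have h1 : ∀ e : ExtremalVar q →₀ ℕ, multigradedBetti (extremalIdeal k q ^ r) i (monDeg e) =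
        Nat.card {j // deg i j = monDeg e} := fun e =>
      h.multigradedBetti_eq hs (monomialIdeal_pow_le _ r) i _
    simp only [h1]
    obtain ⟨f⟩ := hemb (monDeg μ)
    refine (Nat.card_le_card_of_injective f f.injective).trans ?_
    rw [← Finset.sum_coe_sort, ← Nat.card_sigma]
    -- Generators of pushed-forward degree `μ` are sorted by their original degree, which is an lcm
    -- and so lies in the fiber over `μ`.
    have h2 : ∀ j : {j // (psiDeg m ∘ deg i) j = monDeg μ},
        ∃ e ∈ lcmFiber k m r μ, deg i j.1 = monDeg e := by
      rintro ⟨j, hj⟩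
      obtain ⟨e, he, hej⟩ := hlcm i j
      exact ⟨e, (mem_lcmFiber m).2 ⟨he, hej ▸ hj⟩, hej.symm⟩
    choose g hg1 hg2 using h2
    refine Nat.card_le_card_of_injective (fun j => ⟨⟨g j, hg1 j⟩, ⟨j.1, hg2 j⟩⟩ :
      _ → Σ e : lcmFiber k m r μ, {j // deg i j = monDeg e.1}) fun j j' hjj => ?_
    exact Subtype.ext (congrArg (fun p : Σ e : lcmFiber k m r μ,
      {j // deg i j = monDeg e.1} => p.2.1) hjj)
  · rw [h'.totalBetti_eq hs' (monomialIdeal_pow_le m r), extremalIdeal,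
      h.totalBetti_eq hs (monomialIdeal_pow_le _ r)]
    obtain ⟨f⟩ := nonempty_embedding_of_fibers hemb
    exact Nat.card_le_card_of_injective f f.injective

end Psi

theorem theoremt {k : Type u} [Field k] {n q r : ℕ} (hq : 0 < q) (hr : 0 < r)
    (m : Fin q → Fin n →₀ ℕ) (hsqfree : ∀ j t, m j t ≤ 1) :
    (∀ F : GradedComplex (MvPolynomial (ExtremalVar q) k) (ExtremalVar q → ℤ),
      IsMultigradedFreeResolution F (extremalIdeal k q ^ r) →
        IsMultigradedFreeResolution (psiBaseChange m F) (monomialIdeal k m ^ r) ∧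
        ∀ l : ℕ, (∀ i, l < i → Subsingleton (F.X i)) →
          ∀ i, l < i → Subsingleton ((psiBaseChange m F).X i)) ∧
    (∀ Δ : PreAbstractSimplicialComplex (PowerIndex q r),
      SupportsResolution k Δ (powerLabel (extremalGen q)) (extremalIdeal k q ^ r) →
        SupportsResolution k Δ (powerLabel m) (monomialIdeal k m ^ r)) ∧
    (∀ (i : ℕ) (μ : Fin n →₀ ℕ),
      multigradedBetti (monomialIdeal k m ^ r) i (monDeg μ) ≤
        ∑ e ∈ lcmFiber k m r μ, multigradedBetti (extremalIdeal k q ^ r) i (monDeg e)) ∧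
    (∀ i : ℕ, totalBetti (monomialIdeal k m ^ r) i ≤ totalBetti (extremalIdeal k q ^ r) i) := by
  refine ⟨fun F hF => ⟨psiBaseChange_isMultigradedFreeResolution hsqfree hF, fun l hl i hi => ?_⟩,
    fun Δ hΔ => hΔ.relabel hsqfree, fun i => (betti_le hsqfree r i).1,
    fun i => (betti_le hsqfree r i).2⟩
  let : Algebra (MvPolynomial (ExtremalVar q) k) (MvPolynomial (Fin n) k) :=
    (psi k m).toRingHom.toAlgebra
  have := hl i hi
  exact inferInstanceAs (Subsingleton
    (MvPolynomial (Fin n) k ⊗[MvPolynomial (ExtremalVar q) k] F.X i))
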